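/- Equip $\mathbb C$ with the measure $dx\,dy/\pi$, and let $$\mathcal H=\bigl\{\,z\mapsto e^{-|z|^2/2}f(z)\ :\ f \text{ entire},\ \textstyle\int_{\mathbb C}|f(z)|^2e^{-|z|^2}\,\frac{dx\,dy}{\pi}<\infty\,\bigr\}\subseteq L^2(\mathbb C,dx\,dy/\pi)$$ be the (weighted) Bargmann space, which is a reproducing kernel Hilbert space with the unit-norm kernel functions $$K_w(z)=e^{-(|z|^2+|w|^2)/2}\,e^{z\overline w},\qquad w\in\mathbb C .$$ Let $M_n(z)=e^{-|z|^2/2}\,z^n/\sqrt{n!}$ for $n=0,1,2,\dots$. For a compact set $\Omega\subseteq\mathbb C$ let $\mathcal M(\Omega)$ be the space of complex Borel measures on $\Omega$, let $\|\mu\|_{TV}=|\mu|(\Omega)$ be the total variation norm, and for $\mu\in\mathcal M(\Omega)$ let $K*\mu=\int_\Omega K_w\,d\mu(w)$ (Bochner integral in $L^2(\mathbb C,dx\,dy/\pi)$, with value in $\mathcal H$). **Theorem.** Let $R\ge 1$, let $B_R(0)\subseteq\mathbb C$ be the closed disc of radius $R$, and let $W=\{w_1,\dots,w_s\}\subseteq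 B_R(0)$ be a set of $s$ distinct points. Define $$\overline\sigma(W,z)=\sum_{j=1}^s e^{-\frac12|z-w_j|^2}\bigl(1+|z-w_j|+|z-w_j|^2+|z-w_j|^3\bigr),\qquad \overline\sigma_\uparrow(W)=\sup_{z\in\mathbb C}\overline\sigma(W,z).$$ Suppose that there is a $\tau>0$ for which $$\sup\Bigl\{\ \sum_{j=1}^s e^{-\frac12|z-w_j|^2}\ :\ z\in\mathbb C,\ \operatorname{dist}(z,W)>\frac{\sqrt5-1}{4\,\overline\sigma_\uparrow(W)}\Bigr\}<1-\tau .$$ Then there is an $N_0\in\mathbb N$ such that for all coefficients $c_1,\dots,c_s\in\mathbb C$ the following holds for the signal $f_0=\sum_{k=1}^s c_kK_{w_k}\in\mathcal H$ and the measure $\mu_0=\sum_{k=1}^s c_k\delta_{w_k}$: 1. for every $N\ge N_0$, $\mu_0$ is the unique solution of $$\min_{\mu\in\mathcal M(B_R(0))}\|\mu\|_{TV}\quad\text{subject to}\quad \langle K*\mu,M_n\rangle=\langle f_0,M_n\rangle,\qquad n=0,\dots,N-1;$$ 2. $\mu_0$ is also the unique solution of $\min_{\mu\in\mathcal M(B_R(0))}\|\mu\|_{TV}$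 subject to $K*\mu=f_0$ (the measurement operator being the identity); 3. $K*\mu_0=f_0$, so that $f_0$ is recovered as well. -/

import Mathlib

open MeasureTheory
open scoped ENNReal ComplexConjugate

noncomputable section

namespace GaussianRadar

/-- The normalised Lebesgue measure `dx dy / π` on the complex plane. -/
def planeMeasure : Measure ℂ := ENNReal.ofReal (1 / Real.pi) • volume

/-- The Hilbert space `L²(ℂ, dx dy / π)`. -/
abbrev PlaneL2 : Type := Lp ℂ 2 planeMeasure

/-- The Bargmann space with the Gaussian weight passed onto the functions, i.e. the space of all
`z ↦ exp (-|z|² / 2) f z` in `L²(ℂ, dx dy / π)` with `f` entire. Its norm is thus the Bargmann norm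
`(∫ |f (x + i y)|² exp (-(x² + y²)) dx dy / π) ^ (1 / 2)` of `f`. -/
def radarSpace : Submodule ℂ PlaneL2 where
  carrier := {g | ∃ f : ℂ → ℂ, Differentiable ℂ f ∧
    (g : ℂ → ℂ) =ᵐ[planeMeasure] fun z => (Real.exp (-‖z‖ ^ 2 / 2) : ℂ) * f z}
  zero_mem' := by
    refine ⟨fun _ => 0, differentiable_const _, ?_⟩
    filter_upwards [Lp.coeFn_zero ℂ 2 planeMeasure] with z hz
    rw [mul_zero]
    exact hz
  add_mem' := by
    rintro g₁ g₂ ⟨f₁, hf₁, h₁⟩ ⟨f₂, hf₂, h₂⟩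
    refine ⟨fun z => f₁ z + f₂ z, hf₁.add hf₂, ?_⟩
    filter_upwards [h₁, h₂, Lp.coeFn_add g₁ g₂] with z hz₁ hz₂ hz
    rw [hz, Pi.add_apply, hz₁, hz₂]
    ring
  smul_mem' := by
    rintro a g ⟨f, hf, h⟩
    refine ⟨fun z => a * f z, hf.const_mul a, ?_⟩
    filter_upwards [h, Lp.coeFn_smul a g] with z hz₁ hz
    rw [hz, Pi.smul_apply, hz₁, smul_eq_mul]
    ring

theorem integrable_gaussian_pow (n : ℕ) :
    Integrable (fun z : ℂ => ‖z‖ ^ (2 * n) * Real.exp (-‖z‖ ^ 2)) := by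
  by_contra h
  have h0 := integral_undef h
  have h1 := Complex.integral_rpow_mul_exp_neg_rpow (p := 2) (q := 2 * n) (by norm_num)
    (by have : (0 : ℝ) ≤ n := n.cast_nonneg
        linarith)
  have h2 : 0 < Real.Gamma ((2 * n + 2 : ℝ) / 2) := Real.Gamma_pos_of_pos (by positivity)
  have h3 : ∀ z : ℂ, ‖z‖ ^ (2 * n) * Real.exp (-‖z‖ ^ 2) =
      ‖z‖ ^ (2 * n : ℝ) * Real.exp (-‖z‖ ^ (2 : ℝ)) := by
    intro z
    rw [Real.rpow_two, ← Real.rpow_natCast]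
    norm_cast
  rw [integral_congr_ae (Filter.Eventually.of_forall h3), h1] at h0
  have : 0 < 2 * Real.pi / 2 * Real.Gamma ((2 * n + 2 : ℝ) / 2) := by positivity
  linarith

/-- The unit-norm kernel function `z ↦ exp (-(|z|² + |w|²) / 2) exp (z * conj w)`. -/
def kerFn (w z : ℂ) : ℂ :=
  (Real.exp (-(‖z‖ ^ 2 + ‖w‖ ^ 2) / 2) : ℂ) * Complex.exp (z * conj w)

/-- The weighted monomial `z ↦ exp (-|z|² / 2) z ^ n / √(n!)`. -/
def monoFn (n : ℕ) (z : ℂ) : ℂ :=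
  (Real.exp (-‖z‖ ^ 2 / 2) : ℂ) * (z ^ n / (Real.sqrt n.factorial : ℂ))

theorem norm_kerFn (w z : ℂ) : ‖kerFn w z‖ = Real.exp (-‖z - w‖ ^ 2 / 2) := by
  have h : ‖z - w‖ ^ 2 = ‖z‖ ^ 2 + ‖w‖ ^ 2 - 2 * (z * conj w).re := by
    rw [← Complex.normSq_eq_norm_sq, ← Complex.normSq_eq_norm_sq, ← Complex.normSq_eq_norm_sq,
      Complex.normSq_sub]
  rw [kerFn, norm_mul, Complex.norm_real, Complex.norm_exp, Real.norm_eq_abs, Real.abs_exp,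
    ← Real.exp_add, h]
  congr 1
  ring

theorem memLp_kerFn (w : ℂ) : MemLp (kerFn w) 2 planeMeasure := by
  have hc : Continuous (kerFn w) := by unfold kerFn; fun_prop
  rw [memLp_two_iff_integrable_sq_norm hc.aestronglyMeasurable]
  refine Integrable.smul_measure ?_ ENNReal.ofReal_ne_top
  refine ((integrable_gaussian_pow 0).comp_sub_right w).congr (Filter.Eventually.of_forall ?_)
  intro z
  simp only [norm_kerFn, mul_zero, pow_zero, one_mul]
  rw [← Real.exp_nat_mul]
  congr 1
  push_cast
  ring

theorem memLp_monoFn (n : ℕ) : MemLp (monoFn n) 2 planeMeasure := by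
  have hc : Continuous (monoFn n) := by unfold monoFn; fun_prop
  rw [memLp_two_iff_integrable_sq_norm hc.aestronglyMeasurable]
  refine Integrable.smul_measure ?_ ENNReal.ofReal_ne_top
  refine ((integrable_gaussian_pow n).mul_const (1 / (n.factorial : ℝ))).congr
    (Filter.Eventually.of_forall ?_)
  intro z
  simp only [monoFn, norm_mul, norm_div, norm_pow, Complex.norm_real, Real.norm_eq_abs,
    Real.abs_exp, mul_pow, div_pow, sq_abs]
  rw [Real.sq_sqrt (Nat.cast_nonneg _), ← Real.exp_nat_mul]
  have : ((2 : ℕ) : ℝ) * (-‖z‖ ^ 2 / 2) = -‖z‖ ^ 2 := by push_cast; ring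
  rw [this]
  ring

/-- The unit-norm reproducing kernel `K_w`, as an element of the weighted Bargmann space. -/
def ker (w : ℂ) : radarSpace :=
  ⟨(memLp_kerFn w).toLp _, fun z => (Real.exp (-‖w‖ ^ 2 / 2) : ℂ) * Complex.exp (z * conj w),
    by fun_prop, by
      filter_upwards [(memLp_kerFn w).coeFn_toLp] with z hz
      rw [hz, kerFn, ← mul_assoc, ← Complex.ofReal_mul, ← Real.exp_add]
      congr 4
      ring⟩

/-- The measurement vector `M_n`, as an element of the weighted Bargmann space. -/
def mono (n : ℕ) : radarSpace :=
  ⟨(memLp_monoFn n).toLp _, fun z => z ^ n / (Real.sqrt n.factorial : ℂ),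
    by fun_prop, (memLp_monoFn n).coeFn_toLp⟩

/-- `K * μ = ∫ K_w dμ(w)`, a vector-valued integral (in the sense of Bochner, taken in
`L²(ℂ, dx dy / π)`) against a complex measure `μ` on a set `Ω` of the complex plane. -/
def synth {Ω : Set ℂ} (μ : ComplexMeasure Ω) : PlaneL2 :=
  VectorMeasure.integral μ (fun w : Ω => (ker (w : ℂ) : PlaneL2))
    (ContinuousLinearMap.lsmul ℝ ℂ (E := PlaneL2)).flip

/-- The total variation norm `|μ|(Ω)` of a complex measure on `Ω`. -/
def tvNorm {Ω : Set ℂ} (μ : ComplexMeasure Ω) : ℝ≥0∞ := μ.variation Set.univ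

/-- `μ` solves the problem of minimising the total variation norm over `S`. -/
def IsTVMinimizer {Ω : Set ℂ} (S : Set (ComplexMeasure Ω)) (μ : ComplexMeasure Ω) : Prop :=
  μ ∈ S ∧ ∀ ν ∈ S, tvNorm μ ≤ tvNorm ν

/-- The measure `∑ k, c k • δ_{w k}`. -/
def spikes {Ω : Set ℂ} {s : ℕ} (w : Fin s → Ω) (c : Fin s → ℂ) : ComplexMeasure Ω :=
  ∑ k, VectorMeasure.dirac (w k) (c k)

/-- `σ(W, z) = ∑ j, exp (-|z - w j|² / 2) (1 + |z - w j| + |z - w j|² + |z - w j|³)`. -/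
def sigma {s : ℕ} (w : Fin s → ℂ) (z : ℂ) : ℝ :=
  ∑ j, Real.exp (-‖z - w j‖ ^ 2 / 2) *
    (1 + ‖z - w j‖ + ‖z - w j‖ ^ 2 + ‖z - w j‖ ^ 3)

/-- `σ↑(W) = sup_z σ(W, z)`. -/
def sigmaUp {s : ℕ} (w : Fin s → ℂ) : ℝ := ⨆ z : ℂ, sigma w z

/-- The supremum of `∑ j, exp (-|z - w j|² / 2)` over all `z` whose distance to `W` exceeds
`(√5 - 1) / (4 σ↑(W))`. -/
def farSup {s : ℕ} (w : Fin s → ℂ) : ℝ :=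
  sSup {x | ∃ z : ℂ, (Real.sqrt 5 - 1) / (4 * sigmaUp w) < Metric.infDist z (Set.range w) ∧
    x = ∑ j, Real.exp (-‖z - w j‖ ^ 2 / 2)}

end GaussianRadar

end

/-!
Minimality and uniqueness of `∑ k, c k • δ_{w k}` follow from dual certificates: functions
`η z = exp (-|z|² / 2) * p z`, with `p` a polynomial of degree less than `N₀`, such that `η (w k)`
is the phase of `c k` and `|η| < 1` on the rest of the disc. By the reproducing property
`⟪K_v, g⟫ = g v`, every measure `ν` consistent with `N₀` measurements has the same pairing
`∫ conj η dν = ∑ |c k|` with `η`, so that its total variation is at least `∑ |c k|`; equality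
forces `ν` to live on the points `w k`, and the certificates for the other phases determine its
coefficients there (`HasCertificates.tvNorm_spikes_le`, `HasCertificates.eq_spikes`). More
measurements, or the identity as measurement operator, only make the feasible set smaller.

The hypothesis enters through Gaussian sums `F z = ∑ k, exp (-|z - w k|² / 2)` alone. Since
`σ↑ > 2.6`, the radius `(√5 - 1) / (4 σ↑)` is less than `1 / 8`, so that `F ≤ 1` outside the discs
of radius `1 / 8` about the `w k` (`GaussSparse`). On the circle of radius `1 / 8` about `w j`,
the `j`-th bump alone is nearly `1`, and so the others add up to at most `1 / 127` there, and by
convexity also inside. Hence `F ≤ 128 / 127` everywhere, and all other estimates come from these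
two bounds: after division by the weight, the sum over the other points is a sum of exponentials
of linear functions, which is log-convex along rays (`GaussSparse.crossSum_le_exp`), and averages
of `F` over four points bound the sums with additional factors `|z - w k|` or `cosh (a |z - w k|)`
(`GaussSparse.sum_mul_cosh_le`).

The certificate is sought in the form `∑ k, (α k + β k * (z - w k)) * u k z`, where `u k` is a
Taylor polynomial of the entire function `coherent (w k)` underlying `K_{w k}`. Prescribing at
each `w j` the value, and a vanishing derivative after the origin has been moved to `w j`
(`recenter`), gives a linear system which is dominated by its diagonal. At distance at least `1.3`
from all points the solution is small because `F` is. Within distance `1.3` of `w j`, the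
recentred solution `φ` deviates from its value at `0`, which has modulus `1`, by at most `0.8`,
and to second order; so the Schwarz lemma gives `|φ ζ| ≤ 1 + 0.8 (|ζ| / 1.3)² < exp (|ζ|² / 2)`,
which is the claim (`IsCoherentApprox.exists_comb`).
-/

namespace GaussianRadar

/-! ### Integrals against complex measures, and the reproducing property -/

/-- Continuous linear maps commute with the integral against a complex measure. -/
theorem clm_apply_vectorMeasure_integral {X E F : Type*} [MeasurableSpace X]
    [NormedAddCommGroup E] [NormedSpace ℂ E] [NormedSpace ℝ E] [IsScalarTower ℝ ℂ E]
    [CompleteSpace E]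
    [NormedAddCommGroup F] [NormedSpace ℂ F] [NormedSpace ℝ F] [IsScalarTower ℝ ℂ F]
    [CompleteSpace F]
    (T : E →L[ℂ] F) (μ : ComplexMeasure X) {f : X → E} (hf : μ.Integrable f) :
    T (VectorMeasure.integral μ f (ContinuousLinearMap.lsmul ℝ ℂ (E := E)).flip) =
      VectorMeasure.integral μ (fun x => T (f x))
        (ContinuousLinearMap.lsmul ℝ ℂ (E := F)).flip := by
  revert f
  refine Integrable.induction _ ?_ ?_ ?_ ?_
  · intro c s hs hμs
    have h1 : (fun x => T (s.indicator (fun _ => c) x)) = s.indicator (fun _ => T c) := by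
      ext x; by_cases hx : x ∈ s <;> simp [hx]
    rw [h1]
    simp only [VectorMeasure.integral]
    rw [setToFun_indicator_const _ hs hμs.ne, setToFun_indicator_const _ hs hμs.ne]
    simp [VectorMeasure.transpose]
  · intro f g _ hf hg h1 h2
    have e : (fun x => T ((f + g) x)) = (fun x => T (f x)) + fun x => T (g x) := by
      ext x; simp
    rw [e, VectorMeasure.integral_add hf hg, map_add, h1, h2,
      VectorMeasure.integral_add]
    · exact T.integrable_comp hf
    · exact T.integrable_comp hg
  · have h : ∀ f : X →₁[μ.variation] E,
        VectorMeasure.integral μ (fun x => T (f x))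
          (ContinuousLinearMap.lsmul ℝ ℂ (E := F)).flip =
        VectorMeasure.integral μ (T.compLpL 1 μ.variation f : X → F)
          (ContinuousLinearMap.lsmul ℝ ℂ (E := F)).flip := fun f =>
      VectorMeasure.integral_congr_ae (T.coeFn_compLpL f).symm
    simp only [h]
    exact isClosed_eq (T.continuous.comp VectorMeasure.continuous_integral)
      (VectorMeasure.continuous_integral.comp (T.compLpL 1 μ.variation).continuous)
  · intro f g hfg hf h
    rw [← VectorMeasure.integral_congr_ae hfg, h]
    exact VectorMeasure.integral_congr_ae (hfg.mono fun x hx => by simp [hx])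

theorem integral_circleMap_neg_pi_pi {g : ℂ → ℂ} (hg : Differentiable ℂ g) (r : ℝ) :
    ∫ θ in -Real.pi..Real.pi, g (circleMap 0 r θ) = (2 * Real.pi : ℂ) * g 0 := by
  have h := hg.diffContOnCl (s := Metric.ball 0 |r|) |>.circleAverage
  rw [Real.circleAverage_eq_integral_add (-Real.pi),
    intervalIntegral.integral_comp_add_right (fun θ => g (circleMap 0 r θ))] at h
  have e : (2 * Real.pi + -Real.pi) = Real.pi := by ring
  rw [e, zero_add] at h
  rw [← h, Complex.real_smul]
  push_cast
  rw [mul_inv_cancel_left₀]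
  exact_mod_cast Real.two_pi_pos.ne'

/-- The mean value property, integrated over all radii in polar coordinates. -/
theorem integral_radial_mul_entire {g : ℂ → ℂ} (hg : Differentiable ℂ g)
    (hi : Integrable fun z : ℂ => (Real.exp (-‖z‖ ^ 2) : ℂ) * g z) :
    ∫ z : ℂ, (Real.exp (-‖z‖ ^ 2) : ℂ) * g z = Real.pi * g 0 := by
  set G : ℂ → ℂ := fun z => (Real.exp (-‖z‖ ^ 2) : ℂ) * g z with hG
  have hGc : Continuous G := by
    have := hg.continuous
    fun_prop
  have hsymm : Continuous fun p : ℝ × ℝ => Complex.polarCoord.symm p := by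
    simp only [Complex.polarCoord_symm_apply]
    fun_prop
  have hint : IntegrableOn (fun p : ℝ × ℝ => p.1 • G (Complex.polarCoord.symm p))
      (Set.Ioi 0 ×ˢ Set.Ioo (-Real.pi) Real.pi) (volume.prod volume) := by
    refine ⟨(by fun_prop : Continuous _).aestronglyMeasurable, ?_⟩
    have h1 : ∫⁻ p in Set.Ioi (0 : ℝ) ×ˢ Set.Ioo (-Real.pi) Real.pi,
        ‖p.1 • G (Complex.polarCoord.symm p)‖ₑ ∂(volume.prod volume) = ∫⁻ z, ‖G z‖ₑ := by
      rw [← Complex.lintegral_comp_polarCoord_symm]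
      refine setLIntegral_congr_fun (measurableSet_Ioi.prod measurableSet_Ioo) fun p hp => ?_
      rw [enorm_smul, Real.enorm_eq_ofReal (le_of_lt hp.1), smul_eq_mul]
    rw [HasFiniteIntegral, h1]
    exact hi.2
  rw [← Complex.integral_comp_polarCoord_symm, polarCoord_target, Measure.volume_eq_prod,
    setIntegral_prod _ hint]
  have h2 : ∀ r ∈ Set.Ioi (0 : ℝ),
      ∫ θ in Set.Ioo (-Real.pi) Real.pi, r • G (Complex.polarCoord.symm (r, θ)) =
        (r * Real.exp (-r ^ 2)) • ((2 * Real.pi : ℂ) * g 0) := by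
    intro r hr
    rw [← integral_circleMap_neg_pi_pi hg r, intervalIntegral.integral_of_le
      (by linarith [Real.pi_pos]), ← integral_Ioc_eq_integral_Ioo, ← integral_smul]
    refine integral_congr_ae (Filter.Eventually.of_forall fun θ => ?_)
    have e1 : Complex.polarCoord.symm (r, θ) = circleMap 0 r θ := by
      simp [circleMap, Complex.exp_mul_I]
    simp only [e1, hG, norm_circleMap_zero, sq_abs, Complex.real_smul]
    push_cast
    ring
  rw [setIntegral_congr_fun measurableSet_Ioi h2, integral_smul_const]
  have h3 : ∫ r in Set.Ioi (0 : ℝ), r * Real.exp (-r ^ 2) = 1 / 2 := by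
    have := integral_mul_cexp_neg_mul_sq (b := 1) (by simp)
    have h4 : ∀ r : ℝ, (r : ℂ) * Complex.exp (-1 * (r : ℂ) ^ 2) =
        ((r * Real.exp (-r ^ 2) : ℝ) : ℂ) := by intro r; push_cast; simp
    simp only [h4] at this
    rw [integral_complex_ofReal] at this
    have h5 : ((2 : ℂ) * 1)⁻¹ = ((1 / 2 : ℝ) : ℂ) := by push_cast; norm_num
    rw [h5] at this
    exact_mod_cast this
  rw [h3, Complex.real_smul]
  push_cast
  ring

/-- The reproducing property. The substitution `z = ζ + v` turns the integral into that of an entire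
function of `ζ` against a radial Gaussian. -/
theorem integral_conj_kerFn_mul {f : ℂ → ℂ} (hf : Differentiable ℂ f)
    (h2 : MemLp (fun z => (Real.exp (-‖z‖ ^ 2 / 2) : ℂ) * f z) 2 planeMeasure) (v : ℂ) :
    ∫ z, conj (kerFn v z) * ((Real.exp (-‖z‖ ^ 2 / 2) : ℂ) * f z) ∂planeMeasure =
      (Real.exp (-‖v‖ ^ 2 / 2) : ℂ) * f v := by
  have hi : Integrable (fun z => conj (kerFn v z) * ((Real.exp (-‖z‖ ^ 2 / 2) : ℂ) * f z))
      volume := by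
    have h := MemLp.integrable_mul (memLp_kerFn v).star h2
    have hc : ENNReal.ofReal (1 / Real.pi) ≠ 0 := by
      simp [Real.pi_pos]
    exact (integrable_smul_measure hc ENNReal.ofReal_ne_top).1 h
  have key : ∀ ζ : ℂ, conj (kerFn v (ζ + v)) * ((Real.exp (-‖ζ + v‖ ^ 2 / 2) : ℂ) * f (ζ + v)) =
      (Real.exp (-‖ζ‖ ^ 2) : ℂ) * ((Real.exp (-‖v‖ ^ 2 / 2) : ℂ) *
        (Complex.exp (-(conj v * ζ)) * f (ζ + v))) := by
    intro ζ
    have hn : ∀ z : ℂ, ((‖z‖ ^ 2 : ℝ) : ℂ) = z * conj z := fun z => by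
      rw [Complex.mul_conj, Complex.normSq_eq_norm_sq]
    simp only [kerFn, map_mul, Complex.conj_ofReal, ← Complex.exp_conj, Complex.conj_conj]
    simp only [Complex.ofReal_exp, ← mul_assoc, ← Complex.exp_add]
    congr 2
    push_cast
    simp only [← Complex.ofReal_pow, hn, map_add]
    ring
  have hi' := hi.comp_add_right v
  simp only [key] at hi'
  rw [planeMeasure, integral_smul_measure, ← integral_add_right_eq_self _ v]
  simp only [key]
  rw [integral_radial_mul_entire (by fun_prop) hi', ENNReal.toReal_ofReal (by positivity),
    Complex.real_smul]
  have : (Real.pi : ℂ) ≠ 0 := by exact_mod_cast Real.pi_ne_zero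
  simp

theorem inner_ker_eq {g : PlaneL2} {f : ℂ → ℂ} (hf : Differentiable ℂ f)
    (hg : (g : ℂ → ℂ) =ᵐ[planeMeasure] fun z => (Real.exp (-‖z‖ ^ 2 / 2) : ℂ) * f z) (v : ℂ) :
    inner ℂ (ker v : PlaneL2) g = (Real.exp (-‖v‖ ^ 2 / 2) : ℂ) * f v := by
  rw [← integral_conj_kerFn_mul hf ((memLp_congr_ae hg).1 (Lp.memLp g)) v, L2.inner_def]
  refine integral_congr_ae ?_
  filter_upwards [hg, (memLp_kerFn v).coeFn_toLp] with z h1 h2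
  rw [h1]
  have : ((ker v : PlaneL2) : ℂ → ℂ) z = kerFn v z := h2
  rw [this]
  simp [mul_comm]

theorem inner_mono_ker (n : ℕ) (v : ℂ) :
    inner ℂ (mono n : PlaneL2) (ker v : PlaneL2) = conj (monoFn n v) := by
  rw [← inner_conj_symm, inner_ker_eq (g := (mono n : PlaneL2))
    (f := fun z => z ^ n / (Real.sqrt n.factorial : ℂ)) (by fun_prop)
    (memLp_monoFn n).coeFn_toLp, monoFn]

theorem inner_ker_ker (v w : ℂ) :
    inner ℂ (ker v : PlaneL2) (ker w : PlaneL2) = kerFn w v := by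
  rw [inner_ker_eq (f := fun z => (Real.exp (-‖w‖ ^ 2 / 2) : ℂ) * Complex.exp (z * conj w))
    (by fun_prop), kerFn, ← mul_assoc, ← Complex.ofReal_mul, ← Real.exp_add]
  · congr 4; ring
  · filter_upwards [(memLp_kerFn w).coeFn_toLp] with z hz
    change ((memLp_kerFn w).toLp _ : ℂ → ℂ) z = _
    rw [hz, kerFn, ← mul_assoc, ← Complex.ofReal_mul, ← Real.exp_add]
    congr 4
    ring

/-- By the reproducing property, `‖K_w - K_v‖²` is a combination of values of the kernel, which is
continuous. -/
theorem continuous_ker : Continuous fun w : ℂ => (ker w : PlaneL2) := by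
  have h : ∀ w v : ℂ, ‖(ker w : PlaneL2) - ker v‖ ^ 2 =
      (kerFn w w - kerFn v w - kerFn w v + kerFn v v).re := by
    intro w v
    rw [← inner_self_eq_norm_sq (𝕜 := ℂ), inner_sub_left, inner_sub_right, inner_sub_right]
    simp only [inner_ker_ker]
    simp
    ring
  rw [continuous_iff_continuousAt]
  intro v
  rw [ContinuousAt, tendsto_iff_norm_sub_tendsto_zero]
  have h2 : Filter.Tendsto (fun w => Real.sqrt
      (kerFn w w - kerFn v w - kerFn w v + kerFn v v).re) (nhds v) (nhds 0) := by
    have hc : Continuous fun w => Real.sqrt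
      (kerFn w w - kerFn v w - kerFn w v + kerFn v v).re := by
      unfold kerFn
      fun_prop
    have := hc.tendsto v
    simpa using this
  refine h2.congr fun w => ?_
  rw [← h, Real.sqrt_sq (norm_nonneg _)]

theorem norm_lsmul_flip_le {E : Type*} [NormedAddCommGroup E] [NormedSpace ℂ E] :
    ‖(ContinuousLinearMap.lsmul ℝ ℂ (E := E)).flip‖ ≤ 1 := by
  rw [ContinuousLinearMap.opNorm_flip]
  exact ContinuousLinearMap.opNorm_lsmul_le

/-- If `|g| ≤ 1` and `|∫ g dμ|` reaches the total variation of `μ`, then `μ` vanishes where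
`|g| < 1`. -/
theorem variation_compl_eq_zero_of_le_norm_integral {X : Type*} [MeasurableSpace X]
    (μ : ComplexMeasure X) (hμ : μ.variation Set.univ ≠ ∞) {g : X → ℂ} (hgm : Measurable g)
    (hg : ∀ x, ‖g x‖ ≤ 1) {W : Set X} (hW : ∀ x ∉ W, ‖g x‖ < 1)
    (h : μ.variation Set.univ ≤
      ‖VectorMeasure.integral μ g (ContinuousLinearMap.lsmul ℝ ℂ (E := ℂ)).flip‖ₑ) :
    μ.variation Wᶜ = 0 := by
  have : IsFiniteMeasure μ.variation := ⟨hμ.lt_top⟩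
  have hi : Integrable (fun x => ‖g x‖) μ.variation :=
    Integrable.of_bound hgm.norm.aestronglyMeasurable 1
      (Filter.Eventually.of_forall fun x => by simpa using hg x)
  have h1 : μ.variation.real Set.univ ≤ ∫ x, ‖g x‖ ∂μ.variation := by
    have h2 := ENNReal.toReal_mono (by simp) h
    rw [toReal_enorm] at h2
    refine h2.trans (VectorMeasure.norm_integral_le_integral_norm.trans ?_)
    exact mul_le_of_le_one_left (integral_nonneg fun _ => norm_nonneg _) norm_lsmul_flip_le
  have h3 : ∫ x, (1 - ‖g x‖) ∂μ.variation = 0 := by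
    refine le_antisymm ?_ (integral_nonneg fun x => sub_nonneg.2 (hg x))
    rw [integral_sub (integrable_const 1) hi]
    simpa using h1
  rw [integral_eq_zero_iff_of_nonneg (fun x => sub_nonneg.2 (hg x))
    ((integrable_const 1).sub hi)] at h3
  refine measure_mono_null (fun x hx => ?_) h3
  have := hW x hx
  simp only [Set.mem_compl_iff, Set.mem_ofPred_eq, Pi.zero_apply, sub_eq_zero]
  exact fun h => absurd h this.ne'

theorem eq_sum_dirac_of_variation_compl_eq_zero {X V ι : Type*} [MeasurableSpace X]
    [MeasurableSingletonClass X] [Fintype ι] [NormedAddCommGroup V]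
    (μ : VectorMeasure X V) {w : ι → X} (hw : Function.Injective w)
    (h : μ.variation (Set.range w)ᶜ = 0) :
    μ = ∑ k, VectorMeasure.dirac (w k) (μ {w k}) := by
  classical
  ext s hs
  have hsum : (∑ k, VectorMeasure.dirac (w k) (μ {w k})) s =
      ∑ k, (VectorMeasure.dirac (w k) (μ {w k})) s := by
    simp
  have hfin : (Set.range w).Finite := Set.finite_range w
  have h1 : μ (s \ Set.range w) = 0 := by
    have h2 := VectorMeasure.enorm_measure_le_variation μ (s \ Set.range w)
    rw [measure_mono_null (fun x hx => hx.2) h] at h2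
    simpa using h2
  have h3 : s ∩ Set.range w = ⋃ k ∈ Finset.univ.filter (fun k => w k ∈ s), {w k} := by
    ext x
    simp only [Set.mem_inter_iff, Set.mem_range, Finset.mem_filter, Finset.mem_univ, true_and,
      Set.mem_iUnion, Set.mem_singleton_iff, exists_prop]
    constructor
    · rintro ⟨hx, k, rfl⟩
      exact ⟨k, hx, rfl⟩
    · rintro ⟨k, hk, rfl⟩
      exact ⟨hk, k, rfl⟩
  have h4 : μ (s ∩ Set.range w) = ∑ k with w k ∈ s, μ {w k} := by
    rw [h3, VectorMeasure.of_biUnion_finset]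
    · intro i _ j _ hij
      simpa using fun e => hij (hw e)
    · intro k _
      exact measurableSet_singleton _
  have h5 : μ s = μ (s ∩ Set.range w) + μ (s \ Set.range w) := by
    rw [← VectorMeasure.of_union _ (hs.inter hfin.measurableSet) (hs.diff hfin.measurableSet),
      Set.inter_union_sdiff]
    exact Set.disjoint_sdiff_inter.symm
  rw [h5, h1, add_zero, h4, hsum, Finset.sum_filter]
  refine Finset.sum_congr rfl fun k _ => ?_
  by_cases hk : w k ∈ s <;> simp [hk, hs]

theorem tvNorm_spikes_le_sum {Ω : Set ℂ} {s : ℕ} (w : Fin s → Ω) (c : Fin s → ℂ) :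
    tvNorm (spikes w c) ≤ ∑ k, ‖c k‖ₑ := by
  unfold tvNorm spikes
  refine ((VectorMeasure.variation_finsetSum_le _ _) _).trans ?_
  simp

/-- Integration of a vector-valued function against `∑ k, c k • δ_{w k}`. -/
theorem integral_spikes {Ω : Set ℂ} {s : ℕ} (w : Fin s → Ω) (c : Fin s → ℂ) {E : Type*}
    [NormedAddCommGroup E] [NormedSpace ℂ E] [CompleteSpace E] (g : Ω → E) :
    VectorMeasure.integral (spikes w c) g (ContinuousLinearMap.lsmul ℝ ℂ (E := E)).flip =
      ∑ k, c k • g (w k) := by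
  unfold spikes
  have hi : ∀ k ∈ Finset.univ, (VectorMeasure.dirac (w k) (c k)).Integrable g := by
    intro k _
    simp only [VectorMeasure.Integrable, VectorMeasure.variation_dirac]
    exact (integrable_dirac (by simp)).smul_measure (by simp)
  rw [VectorMeasure.integral_finsetSum_vectorMeasure hi]
  simp

theorem synth_spikes {Ω : Set ℂ} {s : ℕ} (w : Fin s → Ω) (c : Fin s → ℂ) :
    synth (spikes w c) = ∑ k, c k • (ker (w k : ℂ) : PlaneL2) :=
  integral_spikes w c _

/-- Scalar products with `K * ν` are integrals against `ν`: the integrand `K_w` is bounded and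
continuous, so that it is integrable as soon as `ν` has finite total variation. -/
theorem inner_synth {Ω : Set ℂ} (g : PlaneL2) (ν : ComplexMeasure Ω) (hν : tvNorm ν ≠ ∞) :
    inner ℂ g (synth ν) = VectorMeasure.integral ν (fun w : Ω => inner ℂ g (ker (w : ℂ) : PlaneL2))
      (ContinuousLinearMap.lsmul ℝ ℂ (E := ℂ)).flip := by
  have : IsFiniteMeasure ν.variation := ⟨lt_top_iff_ne_top.2 hν⟩
  have hn : ∀ w, ‖(ker w : PlaneL2)‖ = 1 := by
    intro w
    have := inner_self_eq_norm_sq (𝕜 := ℂ) (ker w : PlaneL2)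
    rw [inner_ker_ker] at this
    have h2 : kerFn w w = 1 := by
      rw [kerFn, Complex.mul_conj, Complex.normSq_eq_norm_sq, Complex.ofReal_exp, ← Complex.exp_add]
      push_cast
      ring_nf
      simp
    rw [h2] at this
    have h3 : ‖(ker w : PlaneL2)‖ ^ 2 = 1 := by simpa using this.symm
    exact (pow_eq_one_iff_of_nonneg (norm_nonneg _) two_ne_zero).1 h3
  have hi : ν.Integrable fun w : Ω => (ker (w : ℂ) : PlaneL2) := by
    have hc : Continuous fun w : Ω => (ker (w : ℂ) : PlaneL2) :=
      continuous_ker.comp continuous_subtype_val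
    exact Integrable.of_bound hc.aestronglyMeasurable 1
      (Filter.Eventually.of_forall fun w => (hn w).le)
  exact clm_apply_vectorMeasure_integral (innerSL ℂ g) ν hi

/-! ### Gaussian sums over sparse points -/

section Certificate

variable {ι : Type*} [Fintype ι]

/-- The Gaussian sum `∑ k, exp (-|z - w k|² / 2)`. -/
noncomputable def gaussSum (w : ι → ℂ) (z : ℂ) : ℝ := ∑ k, Real.exp (-‖z - w k‖ ^ 2 / 2)

/-- The points `w` are sparse in the sense of Gaussian sums: outside the discs of radius `1 / 8`
about them, the Gaussian sum is at most `1`. -/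
def GaussSparse (w : ι → ℂ) : Prop := ∀ z, (∀ k, 1 / 8 ≤ ‖z - w k‖) → gaussSum w z ≤ 1

open Classical in
/-- The part of the Gaussian sum due to the points other than `w j`, seen from `w j`:
`exp (-|ζ|² / 2) * crossSum w j ζ` is its value at `w j + ζ`. -/
noncomputable def crossSum (w : ι → ℂ) (j : ι) (ζ : ℂ) : ℝ :=
  ∑ k ∈ Finset.univ.erase j,
    Real.exp (-‖w j - w k‖ ^ 2 / 2) * Real.exp ((ζ * conj (w k - w j)).re)

theorem exp_neg_norm_add_sub (v ζ u : ℂ) :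
    Real.exp (-‖v + ζ - u‖ ^ 2 / 2) = Real.exp (-‖ζ‖ ^ 2 / 2) *
      (Real.exp (-‖v - u‖ ^ 2 / 2) * Real.exp ((ζ * conj (u - v)).re)) := by
  rw [← Real.exp_add, ← Real.exp_add]
  congr 1
  simp only [← Complex.normSq_eq_norm_sq, Complex.normSq_apply]
  simp
  ring

theorem gaussSum_add (w : ι → ℂ) (j : ι) (ζ : ℂ) :
    gaussSum w (w j + ζ) = Real.exp (-‖ζ‖ ^ 2 / 2) * (1 + crossSum w j ζ) := by
  classical
  unfold gaussSum crossSum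
  rw [← Finset.add_sum_erase _ _ (Finset.mem_univ j), mul_add, Finset.mul_sum]
  congr 1
  · simp
  · convert rfl using 2 with k
    exact (exp_neg_norm_add_sub _ _ _).symm

theorem crossSum_nonneg (w : ι → ℂ) (j : ι) (ζ : ℂ) : 0 ≤ crossSum w j ζ :=
  Finset.sum_nonneg fun _ _ => by positivity

/-- Interpolation of `crossSum` between `0` and `ζ`, from the convexity of the exponential; the
choice of `l` makes it as good as log-convexity. -/
theorem crossSum_mul_le (w : ι → ℂ) (j : ι) (ζ : ℂ) {a : ℝ} (ha₀ : 0 ≤ a) (ha₁ : a ≤ 1) (l : ℝ) :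
    crossSum w j (a * ζ) ≤
      Real.exp (a * l) * (a * (Real.exp (-l) * crossSum w j ζ) + (1 - a) * crossSum w j 0) := by
  have h : ∀ x : ℝ, Real.exp (a * x) ≤
      Real.exp (a * l) * (a * (Real.exp (-l) * Real.exp x) + (1 - a)) := by
    intro x
    have h := convexOn_exp.2 (Set.mem_univ (x - l)) (Set.mem_univ 0) ha₀
      (sub_nonneg.2 ha₁) (by ring)
    simp only [smul_eq_mul, mul_zero, add_zero, Real.exp_zero, mul_one] at h
    calc Real.exp (a * x) = Real.exp (a * l) * Real.exp (a * (x - l)) := by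
          rw [← Real.exp_add]; ring_nf
      _ ≤ _ := by
          gcongr
          rw [← Real.exp_add, neg_add_eq_sub]
          exact h
  unfold crossSum
  simp only [Finset.mul_sum, ← Finset.sum_add_distrib]
  refine Finset.sum_le_sum fun k _ => ?_
  have e : (a * ζ * conj (w k - w j)).re = a * (ζ * conj (w k - w j)).re := by
    rw [mul_assoc, Complex.re_ofReal_mul]
  rw [e, zero_mul, Complex.zero_re, Real.exp_zero, mul_one]
  calc _ ≤ _ := mul_le_mul_of_nonneg_left (h _) (Real.exp_pos _).le
    _ = _ := by ring

theorem crossSum_zero_le (w : ι → ℂ) (j : ι) (ζ : ℂ) :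
    2 * crossSum w j 0 ≤ crossSum w j ζ + crossSum w j (-ζ) := by
  unfold crossSum
  rw [Finset.mul_sum, ← Finset.sum_add_distrib]
  refine Finset.sum_le_sum fun k _ => ?_
  have h := Real.one_le_cosh (ζ * conj (w k - w j)).re
  rw [Real.cosh_eq] at h
  rw [zero_mul, Complex.zero_re, Real.exp_zero, neg_mul, Complex.neg_re]
  nlinarith [Real.exp_pos (-‖w j - w k‖ ^ 2 / 2)]

theorem exp_one_div_128_le : Real.exp (1 / 128) ≤ 128 / 127 := by
  have h := Real.add_one_le_exp (-(1 / 128) : ℝ)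
  rw [Real.exp_neg] at h
  have h2 := Real.exp_pos (1 / 128)
  have h3 := mul_le_mul_of_nonneg_right h h2.le
  rw [inv_mul_cancel₀ h2.ne'] at h3
  linarith

variable {w : ι → ℂ}

/-- If two of the points were closer than `1`, take the rightmost point `w j` with such a close
neighbour: `w j + 1 / 8` is at distance at least `1 / 8` from all points, but both bumps are large
there. -/
theorem GaussSparse.one_le_norm_sub (h : GaussSparse w) {j k : ι} (hjk : j ≠ k) :
    1 ≤ ‖w j - w k‖ := by
  classical
  by_contra! hlt
  let B : Finset ι := Finset.univ.filter fun j => ∃ k, j ≠ k ∧ ‖w j - w k‖ < 1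
  obtain ⟨m, hmB, hm⟩ := B.exists_max_image (fun j => (w j).re)
    ⟨j, by simp only [B, Finset.mem_filter, Finset.mem_univ, true_and]; exact ⟨k, hjk, hlt⟩⟩
  simp only [B, Finset.mem_filter, Finset.mem_univ, true_and] at hmB hm
  obtain ⟨n, hmn, hn⟩ := hmB
  have hfar : ∀ l, 1 / 8 ≤ ‖w m + (1 / 8 : ℝ) - w l‖ := by
    intro l
    by_cases hl : l = m
    · rw [hl, add_sub_cancel_left, Complex.norm_real]; norm_num
    by_cases hc : ‖w m - w l‖ < 1
    · have h1 := hm l ⟨m, hl, by rwa [norm_sub_rev]⟩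
      refine le_trans ?_ (Complex.re_le_norm _)
      simp only [Complex.sub_re, Complex.add_re, Complex.ofReal_re]
      linarith
    · have h2 := norm_sub_norm_le (w m - w l) (-((1 / 8 : ℝ) : ℂ))
      rw [norm_neg, Complex.norm_real, sub_neg_eq_add] at h2
      rw [add_sub_right_comm]
      norm_num at h2 hc ⊢
      linarith
  have h1 := h _ hfar
  have h2 : Real.exp (-‖w m + (1 / 8 : ℝ) - w m‖ ^ 2 / 2) +
      Real.exp (-‖w m + (1 / 8 : ℝ) - w n‖ ^ 2 / 2) ≤ gaussSum w (w m + (1 / 8 : ℝ)) := by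
    rw [gaussSum, ← Finset.sum_pair hmn (f := fun l =>
      Real.exp (-‖w m + (1 / 8 : ℝ) - w l‖ ^ 2 / 2))]
    exact Finset.sum_le_sum_of_subset_of_nonneg (Finset.subset_univ _)
      fun _ _ _ => (Real.exp_pos _).le
  have h3 : ‖w m + (1 / 8 : ℝ) - w n‖ ≤ 9 / 8 := by
    rw [add_sub_right_comm]
    refine (norm_add_le _ _).trans ?_
    rw [Complex.norm_real]
    norm_num
    linarith
  have h4 : ‖w m + (1 / 8 : ℝ) - w m‖ = 1 / 8 := by
    rw [add_sub_cancel_left, Complex.norm_real]; norm_num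
  rw [h4] at h2
  have h5 := Real.add_one_le_exp (-(1 / 8 : ℝ) ^ 2 / 2)
  have h6 := Real.add_one_le_exp (-‖w m + (1 / 8 : ℝ) - w n‖ ^ 2 / 2)
  have h7 : ‖w m + (1 / 8 : ℝ) - w n‖ ^ 2 ≤ (9 / 8) ^ 2 := by gcongr
  linarith

/-- On the circle of radius `1 / 8` about `w j` the bump of `w j` nearly exhausts the bound `1`. -/
theorem GaussSparse.crossSum_le (h : GaussSparse w) (j : ι) {ζ : ℂ} (hζ : ‖ζ‖ = 1 / 8) :
    crossSum w j ζ ≤ 1 / 127 := by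
  have h1 : gaussSum w (w j + ζ) ≤ 1 := by
    refine h _ fun k => ?_
    by_cases hk : j = k
    · rw [← hk, add_sub_cancel_left, hζ]
    · have h2 := h.one_le_norm_sub hk
      have h3 := norm_sub_norm_le (w j - w k) (-ζ)
      rw [norm_neg, hζ, sub_neg_eq_add] at h3
      rw [add_sub_right_comm]
      linarith
  rw [gaussSum_add, hζ] at h1
  have h2 : Real.exp (-(1 / 8 : ℝ) ^ 2 / 2) = (Real.exp (1 / 128))⁻¹ := by
    rw [← Real.exp_neg]; norm_num
  rw [h2, inv_mul_le_iff₀ (Real.exp_pos _)] at h1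
  linarith [exp_one_div_128_le]

theorem GaussSparse.crossSum_zero_le (h : GaussSparse w) (j : ι) : crossSum w j 0 ≤ 1 / 127 := by
  have h1 := GaussianRadar.crossSum_zero_le w j ((1 / 8 : ℝ) : ℂ)
  have h2 : ‖((1 / 8 : ℝ) : ℂ)‖ = 1 / 8 := by rw [Complex.norm_real]; norm_num
  linarith [h.crossSum_le j h2, h.crossSum_le j ((norm_neg _).trans h2)]

/-- Within distance `1 / 8` of `w j`, convexity along the ray from `w j` extends the bound on the
circle to the disc. -/
theorem GaussSparse.gaussSum_le (h : GaussSparse w) (z : ℂ) : gaussSum w z ≤ 128 / 127 := by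
  by_cases hz : ∀ k, 1 / 8 ≤ ‖z - w k‖
  · linarith [h z hz]
  push Not at hz
  obtain ⟨j, hj⟩ := hz
  obtain ⟨ζ, rfl⟩ : ∃ ζ, z = w j + ζ := ⟨z - w j, by ring⟩
  rw [add_sub_cancel_left] at hj
  have hc : crossSum w j ζ ≤ 1 / 127 := by
    by_cases h0 : ζ = 0
    · rw [h0]; exact h.crossSum_zero_le j
    have hp : 0 < ‖ζ‖ := norm_pos_iff.2 h0
    have h1 := crossSum_mul_le w j (((1 / (8 * ‖ζ‖) : ℝ) : ℂ) * ζ) (a := 8 * ‖ζ‖)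
      (by positivity) (by linarith) 0
    rw [← mul_assoc, ← Complex.ofReal_mul, mul_one_div_cancel (by positivity), Complex.ofReal_one,
      one_mul, mul_zero, neg_zero, Real.exp_zero, one_mul, one_mul] at h1
    have h2 : ‖((1 / (8 * ‖ζ‖) : ℝ) : ℂ) * ζ‖ = 1 / 8 := by
      rw [norm_mul, Complex.norm_real, Real.norm_of_nonneg (by positivity)]
      field_simp
    have h3 := h.crossSum_le j h2
    have h4 := h.crossSum_zero_le j
    nlinarith
  rw [gaussSum_add]
  have h5 : Real.exp (-‖ζ‖ ^ 2 / 2) ≤ 1 := Real.exp_le_one_iff.2 (by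
    have := sq_nonneg ‖ζ‖; linarith)
  nlinarith [crossSum_nonneg w j ζ]

theorem exp_24_div_5_le : Real.exp (24 / 5) ≤ 127 := by
  have e : Real.exp (24 / 5) = Real.exp 1 ^ 5 * Real.exp (-(1 / 5)) := by
    rw [← Real.exp_nat_mul, ← Real.exp_add]; norm_num
  have h2 : Real.exp (-(1 / 5)) ≤ 5 / 6 := by
    rw [Real.exp_neg, inv_le_comm₀ (Real.exp_pos _) (by norm_num)]
    have := Real.add_one_le_exp (1 / 5 : ℝ)
    norm_num at this ⊢
    linarith
  have h3 : Real.exp 1 ^ 5 ≤ 2.71829 ^ 5 := by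
    gcongr; linarith [Real.exp_one_lt_d9]
  rw [e]
  calc _ ≤ (2.71829 : ℝ) ^ 5 * (5 / 6) := by gcongr
    _ ≤ _ := by norm_num

/-- On the circle of radius `3` the whole Gaussian sum is bounded, and at `0` the sum over the other
points is small. Interpolation gives a bound as strong as if there were one other point, at
distance about `3.1`. -/
theorem GaussSparse.crossSum_le_exp (h : GaussSparse w) (j : ι) {ζ : ℂ} (hζ : ‖ζ‖ ≤ 3) :
    crossSum w j ζ ≤ Real.exp (-(24 / 5) + 31 / 10 * ‖ζ‖) := by
  have h0 : crossSum w j 0 ≤ Real.exp (-(24 / 5)) := by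
    refine (h.crossSum_zero_le j).trans ?_
    rw [Real.exp_neg, one_div]
    exact inv_anti₀ (Real.exp_pos _) exp_24_div_5_le
  by_cases hz : ζ = 0
  · simpa [hz] using h0
  have hp : 0 < ‖ζ‖ := norm_pos_iff.2 hz
  set ξ : ℂ := ((3 / ‖ζ‖ : ℝ) : ℂ) * ζ with hξ
  have hnξ : ‖ξ‖ = 3 := by
    rw [hξ, norm_mul, Complex.norm_real, Real.norm_of_nonneg (by positivity)]
    field_simp
  have h1 : crossSum w j ξ ≤ Real.exp (9 / 2) := by
    have h2 := h.gaussSum_le (w j + ξ)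
    rw [gaussSum_add, hnξ] at h2
    have e : Real.exp (-3 ^ 2 / 2) = (Real.exp (9 / 2))⁻¹ := by rw [← Real.exp_neg]; norm_num
    rw [e, inv_mul_le_iff₀ (Real.exp_pos _)] at h2
    linarith [(Real.exp_le_exp.2 (by norm_num : (9 / 2 : ℝ) ≤ 24 / 5)).trans exp_24_div_5_le]
  have h3 := crossSum_mul_le w j ξ (a := ‖ζ‖ / 3) (by positivity) (by linarith) (93 / 10)
  have e2 : ((‖ζ‖ / 3 : ℝ) : ℂ) * ξ = ζ := by
    rw [hξ, ← mul_assoc, ← Complex.ofReal_mul]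
    have : ‖ζ‖ / 3 * (3 / ‖ζ‖) = 1 := by field_simp
    rw [this]; simp
  rw [e2] at h3
  have h4 : Real.exp (-(93 / 10)) * crossSum w j ξ ≤ Real.exp (-(24 / 5)) := by
    calc _ ≤ Real.exp (-(93 / 10)) * Real.exp (9 / 2) := by gcongr
      _ = _ := by rw [← Real.exp_add]; norm_num
  calc crossSum w j ζ ≤ _ := h3
    _ ≤ Real.exp (‖ζ‖ / 3 * (93 / 10)) *
        (‖ζ‖ / 3 * Real.exp (-(24 / 5)) + (1 - ‖ζ‖ / 3) * Real.exp (-(24 / 5))) := by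
      have : 0 ≤ 1 - ‖ζ‖ / 3 := by linarith
      gcongr
    _ = _ := by
      rw [← add_mul, add_sub_cancel, one_mul, ← Real.exp_add]
      congr 1
      ring

/-- Convexity of `x ↦ cosh √x`, which has a power series with nonnegative coefficients. -/
theorem two_mul_cosh_le {r p q : ℝ} (h : r ^ 2 = (p ^ 2 + q ^ 2) / 2) :
    2 * Real.cosh r ≤ Real.cosh p + Real.cosh q := by
  refine hasSum_le (fun n => ?_) ((Real.hasSum_cosh r).mul_left 2)
    ((Real.hasSum_cosh p).add (Real.hasSum_cosh q))
  rw [← add_div, ← mul_div_assoc, pow_mul, pow_mul, pow_mul, h]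
  gcongr
  have := (convexOn_pow n).2 (sq_nonneg p) (sq_nonneg q) (one_half_pos (α := ℝ)).le
    (one_half_pos (α := ℝ)).le (by norm_num)
  simp only [smul_eq_mul] at this
  have e : 1 / 2 * p ^ 2 + 1 / 2 * q ^ 2 = (p ^ 2 + q ^ 2) / 2 := by ring
  rw [e] at this
  linarith

/-- Averaging the Gaussian sum over the four points `z + a * (± 1 ± I)`. -/
theorem GaussSparse.sum_mul_cosh_le (h : GaussSparse w) (z : ℂ) (a : ℝ) :
    ∑ k, Real.exp (-‖z - w k‖ ^ 2 / 2) * Real.cosh (a * ‖z - w k‖) ≤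
      128 / 127 * Real.exp (a ^ 2) := by
  have key : ∀ y : ℂ, 4 * (Real.exp (-(a ^ 2)) * (Real.exp (-‖y‖ ^ 2 / 2) * Real.cosh (a * ‖y‖))) ≤
      Real.exp (-‖y + ⟨a, a⟩‖ ^ 2 / 2) + Real.exp (-‖y + ⟨-a, -a⟩‖ ^ 2 / 2) +
      (Real.exp (-‖y + ⟨a, -a⟩‖ ^ 2 / 2) + Real.exp (-‖y + ⟨-a, a⟩‖ ^ 2 / 2)) := by
    intro y
    have hc := two_mul_cosh_le (r := a * ‖y‖) (p := a * (y.re + y.im)) (q := a * (y.re - y.im)) (by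
      rw [mul_pow, ← Complex.normSq_eq_norm_sq, Complex.normSq_apply]; ring)
    rw [Real.cosh_eq (a * (y.re + y.im)), Real.cosh_eq (a * (y.re - y.im))] at hc
    have e : ∀ u v : ℝ, u ^ 2 = a ^ 2 → v ^ 2 = a ^ 2 → Real.exp (-‖y + ⟨u, v⟩‖ ^ 2 / 2) =
        Real.exp (-(a ^ 2)) * (Real.exp (-‖y‖ ^ 2 / 2) * Real.exp (-(u * y.re + v * y.im))) := by
      intro u v hu hv
      rw [← Real.exp_add, ← Real.exp_add]
      congr 1
      simp only [← Complex.normSq_eq_norm_sq, Complex.normSq_apply, Complex.add_re, Complex.add_im]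
      linear_combination -(1 / 2) * hu - (1 / 2) * hv
    rw [e a a rfl rfl, e (-a) (-a) (by ring) (by ring), e a (-a) rfl (by ring),
      e (-a) a (by ring) rfl]
    have hp : 0 < Real.exp (-(a ^ 2)) * Real.exp (-‖y‖ ^ 2 / 2) := by positivity
    have h1 : -(a * y.re + a * y.im) = -(a * (y.re + y.im)) := by ring
    have h2 : -(-a * y.re + -a * y.im) = a * (y.re + y.im) := by ring
    have h3 : -(a * y.re + -a * y.im) = -(a * (y.re - y.im)) := by ring
    have h4 : -(-a * y.re + a * y.im) = a * (y.re - y.im) := by ring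
    rw [h1, h2, h3, h4]
    have := mul_le_mul_of_nonneg_left hc hp.le
    linarith
  have hs : 4 * (Real.exp (-(a ^ 2)) *
      ∑ k, Real.exp (-‖z - w k‖ ^ 2 / 2) * Real.cosh (a * ‖z - w k‖)) ≤
      gaussSum w (z + ⟨a, a⟩) + gaussSum w (z + ⟨-a, -a⟩) +
      (gaussSum w (z + ⟨a, -a⟩) + gaussSum w (z + ⟨-a, a⟩)) := by
    simp only [gaussSum, Finset.mul_sum, ← Finset.sum_add_distrib, add_sub_right_comm]
    exact Finset.sum_le_sum fun k _ => key (z - w k)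
  have h1 := h.gaussSum_le (z + ⟨a, a⟩)
  have h2 := h.gaussSum_le (z + ⟨-a, -a⟩)
  have h3 := h.gaussSum_le (z + ⟨a, -a⟩)
  have h4 := h.gaussSum_le (z + ⟨-a, a⟩)
  rw [Real.exp_neg] at hs
  rw [← div_le_iff₀ (Real.exp_pos _), div_eq_inv_mul]
  linarith

theorem sum_range_le_cosh (n : ℕ) (x : ℝ) :
    ∑ i ∈ Finset.range n, x ^ (2 * i) / (2 * i).factorial ≤ Real.cosh x :=
  sum_le_hasSum _ (fun i _ => by rw [pow_mul]; positivity) (Real.hasSum_cosh x)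

theorem GaussSparse.sum_norm_mul_le (h : GaussSparse w) (z : ℂ) :
    ∑ k, ‖z - w k‖ * Real.exp (-‖z - w k‖ ^ 2 / 2) ≤ 42 / 25 := by
  have h1 := h.sum_mul_cosh_le z (7 / 10)
  have h2 : 49 / 50 * ∑ k, ‖z - w k‖ * Real.exp (-‖z - w k‖ ^ 2 / 2) ≤
      ∑ k, Real.exp (-‖z - w k‖ ^ 2 / 2) * Real.cosh (7 / 10 * ‖z - w k‖) := by
    rw [Finset.mul_sum]
    refine Finset.sum_le_sum fun k _ => ?_
    have h3 := sum_range_le_cosh 2 (7 / 10 * ‖z - w k‖)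
    norm_num [Finset.sum_range_succ, Nat.factorial] at h3
    have h4 : 49 / 50 * ‖z - w k‖ ≤ Real.cosh (7 / 10 * ‖z - w k‖) := by
      nlinarith [sq_nonneg (‖z - w k‖ - 2)]
    have := Real.exp_pos (-‖z - w k‖ ^ 2 / 2)
    nlinarith
  have h5 : Real.exp ((7 / 10) ^ 2) ≤ 163324 / 100000 := by
    have e : Real.exp ((7 / 10) ^ 2) ^ 2 ≤ (163324 / 100000) ^ 2 := by
      have e2 : Real.exp ((7 / 10) ^ 2) ^ 2 = Real.exp 1 * Real.exp (-(1 / 50)) := by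
        rw [← Real.exp_nat_mul, ← Real.exp_add]; norm_num
      have e3 : Real.exp (-(1 / 50)) ≤ 1 / (1 + 1 / 50 + 1 / 5000) := by
        rw [Real.exp_neg, one_div (1 + 1 / 50 + 1 / 5000 : ℝ)]
        refine inv_anti₀ (by norm_num) ?_
        have := Real.quadratic_le_exp_of_nonneg (x := 1 / 50) (by norm_num)
        norm_num at this ⊢
        linarith
      rw [e2]
      calc _ ≤ (2.7182818286 : ℝ) * (1 / (1 + 1 / 50 + 1 / 5000)) := by
            gcongr
            exact Real.exp_one_lt_d9.le
        _ ≤ _ := by norm_num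
    exact le_of_sq_le_sq e (by norm_num)
  linarith

theorem exp_neg_25_div_4_le : Real.exp (-(25 / 4)) ≤ 1 / 500 := by
  have e : Real.exp (25 / 4) = Real.exp 1 ^ 6 * Real.exp (1 / 4) := by
    rw [← Real.exp_nat_mul, ← Real.exp_add]; norm_num
  have h1 : (2.718 : ℝ) ^ 6 ≤ Real.exp 1 ^ 6 := by
    gcongr; linarith [Real.exp_one_gt_d9]
  have h2 : (5 / 4 : ℝ) ≤ Real.exp (1 / 4) := by
    have := Real.add_one_le_exp (1 / 4 : ℝ)
    linarith
  rw [Real.exp_neg, one_div]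
  refine inv_anti₀ (by norm_num) ?_
  rw [e]
  calc (500 : ℝ) ≤ 2.718 ^ 6 * (5 / 4) := by norm_num
    _ ≤ _ := by gcongr

/-- A majorant `a + b * exp (5 / 2 * (x - 5))` of `g` bounds the sum of `g |w j - w k|` with
Gaussian weights over the other points: the weights add up to at most `1 / 127`, and the
exponential moment is small since it is dominated by a `cosh` sum. -/
theorem GaussSparse.sum_erase_mul_le [DecidableEq ι] (h : GaussSparse w) (j : ι) {g : ℝ → ℝ}
    {a b : ℝ} (ha : 0 ≤ a) (hb : 0 ≤ b)
    (hg : ∀ x, 0 ≤ x → g x ≤ a + b * Real.exp (5 / 2 * (x - 5))) :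
    ∑ k ∈ Finset.univ.erase j, g ‖w j - w k‖ * Real.exp (-‖w j - w k‖ ^ 2 / 2) ≤
      a / 127 + b * (128 / 31750) := by
  have h1 := h.sum_mul_cosh_le (w j) (5 / 2)
  have h2 : ∑ k ∈ Finset.univ.erase j,
      Real.exp (-‖w j - w k‖ ^ 2 / 2) * Real.cosh (5 / 2 * ‖w j - w k‖) ≤
      128 / 127 * Real.exp ((5 / 2) ^ 2) := by
    refine le_trans (Finset.sum_le_sum_of_subset_of_nonneg (Finset.erase_subset _ _)
      fun k _ _ => ?_) h1
    have := Real.cosh_pos (5 / 2 * ‖w j - w k‖)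
    positivity
  have h3 : ∑ k ∈ Finset.univ.erase j, Real.exp (-‖w j - w k‖ ^ 2 / 2) ≤ 1 / 127 := by
    have := h.crossSum_zero_le j
    unfold crossSum at this
    simp only [zero_mul, Complex.zero_re, Real.exp_zero, mul_one] at this
    convert this
  calc _ ≤ ∑ k ∈ Finset.univ.erase j, (a * Real.exp (-‖w j - w k‖ ^ 2 / 2) +
        2 * b * Real.exp (-(25 / 2)) *
          (Real.exp (-‖w j - w k‖ ^ 2 / 2) * Real.cosh (5 / 2 * ‖w j - w k‖))) := by
        refine Finset.sum_le_sum fun k _ => ?_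
        have h4 := hg ‖w j - w k‖ (norm_nonneg _)
        have h5 : Real.exp (5 / 2 * (‖w j - w k‖ - 5)) ≤
            2 * (Real.exp (-(25 / 2)) * Real.cosh (5 / 2 * ‖w j - w k‖)) := by
          have e : Real.exp (5 / 2 * (‖w j - w k‖ - 5)) =
              Real.exp (-(25 / 2)) * Real.exp (5 / 2 * ‖w j - w k‖) := by
            rw [← Real.exp_add]; congr 1; ring
          rw [e, Real.cosh_eq]
          have := mul_pos (Real.exp_pos (-(25 / 2))) (Real.exp_pos (-(5 / 2 * ‖w j - w k‖)))
          linarith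
        have h6 := mul_le_mul_of_nonneg_right (h4.trans (add_le_add_right
          (mul_le_mul_of_nonneg_left h5 hb) a)) (Real.exp_pos (-‖w j - w k‖ ^ 2 / 2)).le
        linarith
    _ = a * ∑ k ∈ Finset.univ.erase j, Real.exp (-‖w j - w k‖ ^ 2 / 2) +
        2 * b * Real.exp (-(25 / 2)) * ∑ k ∈ Finset.univ.erase j,
          (Real.exp (-‖w j - w k‖ ^ 2 / 2) * Real.cosh (5 / 2 * ‖w j - w k‖)) := by
        rw [Finset.sum_add_distrib, Finset.mul_sum, Finset.mul_sum]
    _ ≤ a * (1 / 127) + 2 * b * Real.exp (-(25 / 2)) * (128 / 127 * Real.exp ((5 / 2) ^ 2)) := by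
        gcongr
    _ = a / 127 + 256 / 127 * b * Real.exp (-(25 / 4)) := by
        have e : Real.exp (-(25 / 4)) = Real.exp (-(25 / 2)) * Real.exp ((5 / 2) ^ 2) := by
          rw [← Real.exp_add]; norm_num
        rw [e]; ring
    _ ≤ a / 127 + 256 / 127 * b * (1 / 500) := by
        gcongr
        exact exp_neg_25_div_4_le
    _ = _ := by ring

theorem GaussSparse.sum_erase_norm_mul_le [DecidableEq ι] (h : GaussSparse w) (j : ι) :
    ∑ k ∈ Finset.univ.erase j, ‖w j - w k‖ * Real.exp (-‖w j - w k‖ ^ 2 / 2) ≤ 19 / 500 := by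
  refine (h.sum_erase_mul_le j (g := fun x => x) (a := 23 / 5) (b := 2 / 5) (by norm_num)
    (by norm_num) fun x _ => ?_).trans (by norm_num)
  -- The right-hand side is tangent to the identity at `5`.
  linarith [Real.add_one_le_exp (5 / 2 * (x - 5))]

theorem GaussSparse.sum_erase_norm_sq_mul_le [DecidableEq ι] (h : GaussSparse w) (j : ι) :
    ∑ k ∈ Finset.univ.erase j, ‖w j - w k‖ ^ 2 * Real.exp (-‖w j - w k‖ ^ 2 / 2) ≤ 91 / 500 := by
  refine (h.sum_erase_mul_le j (g := fun x => x ^ 2) (a := 21) (b := 4) (by norm_num)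
    (by norm_num) fun x hx => ?_).trans (by norm_num)
  -- The right-hand side is tangent to the square at `5`.
  rcases le_or_gt (5 - 4 / 5) x with h1 | h1
  · have h2 := Real.add_one_le_exp (5 / 4 * (x - 5))
    have h3 : Real.exp (5 / 2 * (x - 5)) = Real.exp (5 / 4 * (x - 5)) ^ 2 := by
      rw [← Real.exp_nat_mul]; congr 1; push_cast; ring
    have h4 : (5 / 4 * (x - 5) + 1) ^ 2 ≤ Real.exp (5 / 4 * (x - 5)) ^ 2 := by
      have : 0 ≤ 5 / 4 * (x - 5) + 1 := by linarith
      gcongr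
    rw [h3]
    nlinarith [sq_nonneg (x - 5)]
  · have := Real.exp_pos (5 / 2 * (x - 5))
    nlinarith

/-- If no point is close to `z`, then the factors `cosh |z - w k|` in the average over four points
are all large. -/
theorem GaussSparse.gaussSum_le_of_far (h : GaussSparse w) {z : ℂ}
    (hz : ∀ k, 9 / 5 ≤ ‖z - w k‖) : gaussSum w z ≤ 883 / 1000 := by
  have h1 := h.sum_mul_cosh_le z 1
  have h2 : (3104 / 1000 : ℝ) ≤ Real.cosh (9 / 5) := by
    refine le_trans ?_ (sum_range_le_cosh 4 (9 / 5))
    norm_num [Finset.sum_range_succ, Nat.factorial]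
  have h3 : 3104 / 1000 * gaussSum w z ≤
      ∑ k, Real.exp (-‖z - w k‖ ^ 2 / 2) * Real.cosh (1 * ‖z - w k‖) := by
    rw [gaussSum, Finset.mul_sum]
    refine Finset.sum_le_sum fun k _ => ?_
    rw [mul_comm, one_mul]
    gcongr
    refine h2.trans (Real.cosh_le_cosh.2 ?_)
    rw [abs_of_pos (by norm_num), abs_of_nonneg (norm_nonneg _)]
    exact hz k
  have h4 := Real.exp_one_lt_d9
  rw [one_pow] at h1
  linarith

/-- At moderate distance from `w j`, the bump of `w j` and the sum over the other points are both
less than `1 / 2`. -/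
theorem GaussSparse.gaussSum_le_of_mid (h : GaussSparse w) (j : ι) {ζ : ℂ}
    (h₁ : 13 / 10 ≤ ‖ζ‖) (h₂ : ‖ζ‖ ≤ 9 / 5) : gaussSum w (w j + ζ) ≤ 883 / 1000 := by
  have h3 := h.crossSum_le_exp j (h₂.trans (by norm_num))
  have h4 : Real.exp (-(21 / 25)) ≤ 433 / 1000 := by
    rw [Real.exp_neg, inv_le_comm₀ (Real.exp_pos _) (by norm_num)]
    refine le_trans ?_ (Real.sum_le_exp_of_nonneg (x := 21 / 25) (by norm_num) 5)
    norm_num [Finset.sum_range_succ, Nat.factorial]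
  rw [gaussSum_add, mul_add, mul_one]
  -- The first exponent is largest at `‖ζ‖ = 13 / 10`, that of the product below at `‖ζ‖ = 9 / 5`.
  have h5 : Real.exp (-‖ζ‖ ^ 2 / 2) ≤ Real.exp (-(21 / 25)) := Real.exp_le_exp.2 (by nlinarith)
  have h6 : Real.exp (-‖ζ‖ ^ 2 / 2) * crossSum w j ζ ≤ Real.exp (-(21 / 25)) := by
    calc _ ≤ Real.exp (-‖ζ‖ ^ 2 / 2) * Real.exp (-(24 / 5) + 31 / 10 * ‖ζ‖) := by gcongr
      _ = Real.exp (-‖ζ‖ ^ 2 / 2 + (-(24 / 5) + 31 / 10 * ‖ζ‖)) := (Real.exp_add _ _).symm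
      _ ≤ _ := Real.exp_le_exp.2 (by nlinarith)
  linarith

theorem GaussSparse.gaussSum_le_of_away (h : GaussSparse w) {z : ℂ}
    (hz : ∀ k, 13 / 10 ≤ ‖z - w k‖) : gaussSum w z ≤ 883 / 1000 := by
  by_cases h1 : ∀ k, 9 / 5 ≤ ‖z - w k‖
  · exact h.gaussSum_le_of_far h1
  push Not at h1
  obtain ⟨j, hj⟩ := h1
  have := h.gaussSum_le_of_mid j (hz j) hj.le
  rwa [add_sub_cancel] at this

/-! ### Combinations of translated kernels -/

/-- The entire function underlying `kerFn`: `kerFn v z = exp (-|z|² / 2) * coherent v z`. -/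
noncomputable def coherent (v z : ℂ) : ℂ := Complex.exp (z * conj v - (‖v‖ ^ 2 / 2 : ℝ))

/-- The entire function `f` seen from `v`. The weight is moved along with the origin, in the sense
of `norm_recenter`. -/
noncomputable def recenter (v : ℂ) (f : ℂ → ℂ) (ζ : ℂ) : ℂ :=
  f (v + ζ) * Complex.exp (-(conj v * ζ) - (‖v‖ ^ 2 / 2 : ℝ))

/-- The combination `∑ k, (α k + β k * (z - w k)) * u k z`. -/
def comb (w : ι → ℂ) (u : ι → ℂ → ℂ) (α β : ι → ℂ) (z : ℂ) : ℂ :=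
  ∑ k, (α k + β k * (z - w k)) * u k z

theorem differentiable_coherent (v : ℂ) : Differentiable ℂ (coherent v) := by
  unfold coherent; fun_prop

theorem differentiable_recenter {f : ℂ → ℂ} (hf : Differentiable ℂ f) (v : ℂ) :
    Differentiable ℂ (recenter v f) := by
  unfold recenter; fun_prop

theorem differentiable_comb {u : ι → ℂ → ℂ} (hu : ∀ k, Differentiable ℂ (u k)) (α β : ι → ℂ) :
    Differentiable ℂ (comb w u α β) := by
  unfold comb; fun_prop

theorem norm_coherent (v z : ℂ) :
    ‖coherent v z‖ = Real.exp (‖z‖ ^ 2 / 2) * Real.exp (-‖z - v‖ ^ 2 / 2) := by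
  rw [coherent, Complex.norm_exp, ← Real.exp_add]
  congr 1
  simp only [← Complex.normSq_eq_norm_sq, Complex.normSq_apply]
  simp
  ring

theorem norm_recenter (v : ℂ) (f : ℂ → ℂ) (ζ : ℂ) :
    ‖recenter v f ζ‖ =
      Real.exp (‖ζ‖ ^ 2 / 2) * (Real.exp (-‖v + ζ‖ ^ 2 / 2) * ‖f (v + ζ)‖) := by
  rw [recenter, norm_mul, Complex.norm_exp, ← mul_assoc, ← Real.exp_add, mul_comm]
  congr 2
  simp only [← Complex.normSq_eq_norm_sq, Complex.normSq_apply]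
  simp
  ring

theorem recenter_zero (v : ℂ) (f : ℂ → ℂ) :
    recenter v f 0 = (Real.exp (-‖v‖ ^ 2 / 2) : ℂ) * f v := by
  simp [recenter, mul_comm, neg_div]

theorem recenter_coherent (v u ζ : ℂ) :
    recenter v (coherent u) ζ = recenter v (coherent u) 0 * Complex.exp (ζ * conj (u - v)) := by
  simp only [recenter, coherent, ← Complex.exp_add, map_sub]
  congr 1
  ring_nf

theorem norm_recenter_coherent_zero (v u : ℂ) :
    ‖recenter v (coherent u) 0‖ = Real.exp (-‖v - u‖ ^ 2 / 2) := by
  rw [norm_recenter, norm_coherent, ← Real.exp_add, ← Real.exp_add, ← Real.exp_add]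
  congr 1
  simp
  ring

theorem recenter_coherent_self_zero (v : ℂ) : recenter v (coherent v) 0 = 1 := by
  simp only [recenter, coherent, ← Complex.exp_add, add_zero]
  rw [Complex.mul_conj, Complex.normSq_eq_norm_sq]
  push_cast
  ring_nf
  simp

theorem recenter_comb_coherent (j : ι) (α β : ι → ℂ) (ζ : ℂ) :
    recenter (w j) (comb w (fun k => coherent (w k)) α β) ζ =
      ∑ k, (α k + β k * (w j + ζ - w k)) * (recenter (w j) (coherent (w k)) 0 *
        Complex.exp (ζ * conj (w k - w j))) := by
  simp only [← recenter_coherent]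
  simp only [recenter, comb, Finset.sum_mul, mul_assoc]

theorem deriv_recenter_comb_coherent (j : ι) (α β : ι → ℂ) :
    deriv (recenter (w j) (comb w (fun k => coherent (w k)) α β)) 0 =
      ∑ k, (β k + (α k + β k * (w j - w k)) * conj (w k - w j)) *
        recenter (w j) (coherent (w k)) 0 := by
  have h : ∀ k, HasDerivAt (fun ζ => (α k + β k * (w j + ζ - w k)) *
      (recenter (w j) (coherent (w k)) 0 * Complex.exp (ζ * conj (w k - w j))))
      ((β k + (α k + β k * (w j - w k)) * conj (w k - w j)) *
        recenter (w j) (coherent (w k)) 0) 0 := by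
    intro k
    have h1 : HasDerivAt (fun ζ : ℂ => α k + β k * (w j + ζ - w k)) (β k) 0 := by
      simpa using ((((hasDerivAt_id (0 : ℂ)).const_add (w j)).sub_const (w k)).const_mul
        (β k)).const_add (α k)
    have h2 : HasDerivAt (fun ζ : ℂ => Complex.exp (ζ * conj (w k - w j)))
        (conj (w k - w j)) 0 := by
      simpa using ((hasDerivAt_id (0 : ℂ)).mul_const (conj (w k - w j))).cexp
    refine (h1.mul (h2.const_mul (recenter (w j) (coherent (w k)) 0))).congr_deriv ?_
    simp only [zero_mul, Complex.exp_zero, add_zero]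
    ring
  have h2 := HasDerivAt.fun_sum fun k (_ : k ∈ Finset.univ) => h k
  rw [← h2.deriv]
  congr 1
  ext ζ
  exact recenter_comb_coherent j α β ζ

/-- The value functionals are dominated by their diagonal. -/
theorem GaussSparse.norm_sub_recenter_le (h : GaussSparse w) {α β : ι → ℂ} {a b : ℝ}
    (hα : ∀ k, ‖α k‖ ≤ a) (hβ : ∀ k, ‖β k‖ ≤ b) (j : ι) :
    ‖recenter (w j) (comb w (fun k => coherent (w k)) α β) 0 - α j‖ ≤
      1 / 127 * a + 19 / 500 * b := by
  classical
  have ha : 0 ≤ a := (norm_nonneg _).trans (hα j)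
  have hb : 0 ≤ b := (norm_nonneg _).trans (hβ j)
  rw [recenter_comb_coherent, ← Finset.add_sum_erase _ _ (Finset.mem_univ j)]
  simp only [recenter_coherent_self_zero, add_zero, sub_self, mul_zero, zero_mul,
    Complex.exp_zero, mul_one, add_sub_cancel_left]
  have h0 := h.crossSum_zero_le j
  unfold crossSum at h0
  simp only [zero_mul, Complex.zero_re, Real.exp_zero, mul_one] at h0
  calc _ ≤ ∑ k ∈ Finset.univ.erase j, (a * Real.exp (-‖w j - w k‖ ^ 2 / 2) +
        b * (‖w j - w k‖ * Real.exp (-‖w j - w k‖ ^ 2 / 2))) := by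
        refine norm_sum_le_of_le _ fun k _ => ?_
        rw [norm_mul, norm_recenter_coherent_zero, ← mul_assoc, ← add_mul]
        gcongr
        refine (norm_add_le _ _).trans ?_
        rw [norm_mul]
        gcongr
        · exact hα k
        · exact hβ k
    _ ≤ a * (1 / 127) + b * (19 / 500) := by
        rw [Finset.sum_add_distrib, ← Finset.mul_sum, ← Finset.mul_sum]
        gcongr
        exact h.sum_erase_norm_mul_le j
    _ = _ := by ring

/-- The derivative functionals are dominated by their diagonal. -/
theorem GaussSparse.norm_sub_deriv_recenter_le (h : GaussSparse w) {α β : ι → ℂ}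
    {a b : ℝ} (hα : ∀ k, ‖α k‖ ≤ a) (hβ : ∀ k, ‖β k‖ ≤ b) (j : ι) :
    ‖deriv (recenter (w j) (comb w (fun k => coherent (w k)) α β)) 0 - β j‖ ≤
      19 / 500 * a + 91 / 500 * b := by
  classical
  have ha : 0 ≤ a := (norm_nonneg _).trans (hα j)
  have hb : 0 ≤ b := (norm_nonneg _).trans (hβ j)
  rw [deriv_recenter_comb_coherent, ← Finset.add_sum_erase _ _ (Finset.mem_univ j)]
  simp only [recenter_coherent_self_zero, sub_self, map_zero, mul_zero, add_zero, mul_one,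
    add_sub_cancel_left]
  calc _ ≤ ∑ k ∈ Finset.univ.erase j, (a * (‖w j - w k‖ * Real.exp (-‖w j - w k‖ ^ 2 / 2)) +
        b * (‖w j - w k‖ ^ 2 * Real.exp (-‖w j - w k‖ ^ 2 / 2))) := by
        refine norm_sum_le_of_le _ fun k hk => ?_
        have hd := h.one_le_norm_sub (Finset.ne_of_mem_erase hk).symm
        rw [norm_mul, norm_recenter_coherent_zero, ← mul_assoc, ← mul_assoc, ← add_mul]
        gcongr
        have e : β k + (α k + β k * (w j - w k)) * conj (w k - w j) =
            α k * conj (w k - w j) + β k * ((1 - ‖w j - w k‖ ^ 2 : ℝ) : ℂ) := by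
          have e2 : ((‖w j - w k‖ ^ 2 : ℝ) : ℂ) = (w j - w k) * conj (w j - w k) := by
            rw [Complex.mul_conj, Complex.normSq_eq_norm_sq]
          rw [Complex.ofReal_sub, e2, Complex.ofReal_one]
          simp only [map_sub]
          ring
        rw [e]
        refine (norm_add_le _ _).trans ?_
        rw [norm_mul, norm_mul, RCLike.norm_conj, Complex.norm_real, norm_sub_rev (w k)]
        gcongr
        · exact hα k
        · exact hβ k
        · rw [Real.norm_eq_abs, abs_le]
          constructor <;> nlinarith
    _ ≤ a * (19 / 500) + b * (91 / 500) := by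
        rw [Finset.sum_add_distrib, ← Finset.mul_sum, ← Finset.mul_sum]
        gcongr
        · exact h.sum_erase_norm_mul_le j
        · exact h.sum_erase_norm_sq_mul_le j
    _ = _ := by ring

theorem norm_comb_coherent_le {α β : ι → ℂ} {a b : ℝ}
    (hα : ∀ k, ‖α k‖ ≤ a) (hβ : ∀ k, ‖β k‖ ≤ b) (z : ℂ) :
    Real.exp (-‖z‖ ^ 2 / 2) * ‖comb w (fun k => coherent (w k)) α β z‖ ≤
      a * gaussSum w z + b * ∑ k, ‖z - w k‖ * Real.exp (-‖z - w k‖ ^ 2 / 2) := by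
  have h1 : ‖comb w (fun k => coherent (w k)) α β z‖ ≤
      ∑ k, Real.exp (‖z‖ ^ 2 / 2) * (a * Real.exp (-‖z - w k‖ ^ 2 / 2) +
        b * (‖z - w k‖ * Real.exp (-‖z - w k‖ ^ 2 / 2))) := by
    refine norm_sum_le_of_le _ fun k _ => ?_
    have e : ∀ p q r : ℝ, p * (a * q + b * (r * q)) = (a + b * r) * (p * q) := by intros; ring
    rw [norm_mul, norm_coherent, e]
    gcongr
    refine (norm_add_le _ _).trans ?_
    rw [norm_mul]
    gcongr
    · exact hα k
    · exact hβ k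
  rw [← Finset.mul_sum, Finset.sum_add_distrib, ← Finset.mul_sum, ← Finset.mul_sum] at h1
  have h2 : Real.exp (-‖z‖ ^ 2 / 2) = (Real.exp (‖z‖ ^ 2 / 2))⁻¹ := by
    rw [← Real.exp_neg, neg_div]
  rw [h2, inv_mul_le_iff₀ (Real.exp_pos _)]
  exact h1

theorem exp_sq_div_two_le : Real.exp ((13 / 10) ^ 2 / 2) ≤ 233 / 100 := by
  have e : Real.exp ((13 / 10) ^ 2 / 2) = Real.exp 1 * Real.exp (-(31 / 200)) := by
    rw [← Real.exp_add]; norm_num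
  have h : Real.exp (-(31 / 200)) ≤ 857 / 1000 := by
    rw [Real.exp_neg, inv_le_comm₀ (Real.exp_pos _) (by norm_num)]
    refine le_trans ?_ (Real.sum_le_exp_of_nonneg (x := 31 / 200) (by norm_num) 4)
    norm_num [Finset.sum_range_succ, Nat.factorial]
  rw [e]
  calc _ ≤ (2.7182818286 : ℝ) * (857 / 1000) := by
        gcongr
        exact Real.exp_one_lt_d9.le
    _ ≤ _ := by norm_num

theorem exp_neg_77_div_100_le : Real.exp (-(77 / 100)) ≤ 464 / 1000 := by
  rw [Real.exp_neg, inv_le_comm₀ (Real.exp_pos _) (by norm_num)]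
  refine le_trans ?_ (Real.sum_le_exp_of_nonneg (x := 77 / 100) (by norm_num) 5)
  norm_num [Finset.sum_range_succ, Nat.factorial]

/-- Near `w j`, only the `j`-th term of a combination is large. -/
theorem GaussSparse.norm_recenter_comb_sub_le (h : GaussSparse w) {α β : ι → ℂ} {a b : ℝ}
    (hα : ∀ k, ‖α k‖ ≤ a) (hβ : ∀ k, ‖β k‖ ≤ b) (j : ι) {ζ : ℂ} (hζ : ‖ζ‖ ≤ 13 / 10) :
    ‖recenter (w j) (comb w (fun k => coherent (w k)) α β) ζ - α j‖ ≤
      464 / 1000 * a + 5215 / 1000 * b := by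
  classical
  have ha : 0 ≤ a := (norm_nonneg _).trans (hα j)
  have hb : 0 ≤ b := (norm_nonneg _).trans (hβ j)
  rw [recenter_comb_coherent, ← Finset.add_sum_erase _ _ (Finset.mem_univ j)]
  simp only [recenter_coherent_self_zero, sub_self, map_zero, mul_zero,
    Complex.exp_zero, mul_one, add_sub_cancel_left, add_assoc, add_sub_assoc]
  have h1 : ‖∑ k ∈ Finset.univ.erase j, (α k + β k * (w j + (ζ - w k))) *
      (recenter (w j) (coherent (w k)) 0 * Complex.exp (ζ * conj (w k - w j)))‖ ≤
      a * crossSum w j ζ + b * (Real.exp (‖ζ‖ ^ 2 / 2) *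
        ∑ k, ‖w j + ζ - w k‖ * Real.exp (-‖w j + ζ - w k‖ ^ 2 / 2)) := by
    calc _ ≤ ∑ k ∈ Finset.univ.erase j,
          (a * (Real.exp (-‖w j - w k‖ ^ 2 / 2) * Real.exp ((ζ * conj (w k - w j)).re)) +
          b * (Real.exp (‖ζ‖ ^ 2 / 2) *
            (‖w j + ζ - w k‖ * Real.exp (-‖w j + ζ - w k‖ ^ 2 / 2)))) := by
          refine norm_sum_le_of_le _ fun k _ => ?_
          have e : Real.exp (‖ζ‖ ^ 2 / 2) *
              (‖w j + ζ - w k‖ * Real.exp (-‖w j + ζ - w k‖ ^ 2 / 2)) = ‖w j + ζ - w k‖ *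
              (Real.exp (-‖w j - w k‖ ^ 2 / 2) * Real.exp ((ζ * conj (w k - w j)).re)) := by
            have e2 : Real.exp (‖ζ‖ ^ 2 / 2) * Real.exp (-‖ζ‖ ^ 2 / 2) = 1 := by
              rw [← Real.exp_add]; ring_nf; exact Real.exp_zero
            rw [exp_neg_norm_add_sub]
            linear_combination (‖w j + ζ - w k‖ * (Real.exp (-‖w j - w k‖ ^ 2 / 2) *
              Real.exp ((ζ * conj (w k - w j)).re))) * e2
          rw [norm_mul, norm_mul, norm_recenter_coherent_zero, Complex.norm_exp, e, ← mul_assoc b,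
            ← add_mul, ← add_sub_assoc]
          gcongr
          refine (norm_add_le _ _).trans ?_
          rw [norm_mul]
          gcongr
          · exact hα k
          · exact hβ k
      _ ≤ _ := by
          rw [Finset.sum_add_distrib, ← Finset.mul_sum, ← Finset.mul_sum, ← Finset.mul_sum]
          unfold crossSum
          gcongr
          exact Finset.subset_univ _
  have h2 : crossSum w j ζ ≤ 464 / 1000 := by
    refine (h.crossSum_le_exp j (hζ.trans (by norm_num))).trans (le_trans ?_ exp_neg_77_div_100_le)
    exact Real.exp_le_exp.2 (by linarith)
  have h3 : Real.exp (‖ζ‖ ^ 2 / 2) ≤ 233 / 100 := by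
    refine le_trans ?_ exp_sq_div_two_le
    gcongr
  have h4 := h.sum_norm_mul_le (w j + ζ)
  have h5 : ‖β j * ζ‖ ≤ b * (13 / 10) := by
    rw [norm_mul]
    gcongr
    exact hβ j
  calc _ ≤ ‖β j * ζ‖ + _ := norm_add_le _ _
    _ ≤ b * (13 / 10) + (a * (464 / 1000) + b * (233 / 100 * (42 / 25))) := by
        refine add_le_add h5 (h1.trans ?_)
        gcongr
    _ ≤ _ := by linarith

/-! ### The dual certificate -/

/-- The functions `u k` approximate `coherent (w k)` on the disc of radius `R + 2`, well enough for
the certificate to be built from them. -/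
structure IsCoherentApprox (w : ι → ℂ) (R : ℝ) (u : ι → ℂ → ℂ) : Prop where
  norm_le : ∀ k, ‖w k‖ ≤ R
  differentiable : ∀ k, Differentiable ℂ (u k)
  approx : ∀ k z, ‖z‖ ≤ R + 2 →
    Fintype.card ι * ((2 * R + 3) * ‖u k z - coherent (w k) z‖) ≤ 1 / 2000

namespace IsCoherentApprox

variable {R : ℝ} {u : ι → ℂ → ℂ} {α β : ι → ℂ} {a b : ℝ}

/-- Replacing `coherent (w k)` by `u k` changes a combination by little on the disc. -/
theorem norm_comb_sub_le (hu : IsCoherentApprox w R u) (hα : ∀ k, ‖α k‖ ≤ a)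
    (hβ : ∀ k, ‖β k‖ ≤ b) (ha : 0 ≤ a) (hb : 0 ≤ b) {z : ℂ} (hz : ‖z‖ ≤ R + 2) :
    ‖comb w u α β z - comb w (fun k => coherent (w k)) α β z‖ ≤ (a + b) / 2000 := by
  unfold comb
  rw [← Finset.sum_sub_distrib]
  have h : ∀ k, ‖(α k + β k * (z - w k)) * u k z - (α k + β k * (z - w k)) * coherent (w k) z‖ ≤
      (a + b) / 2000 / Fintype.card ι := by
    intro k
    have hR : 0 ≤ R := (norm_nonneg _).trans (hu.norm_le k)
    have hc : (0 : ℝ) < Fintype.card ι := by exact_mod_cast Fintype.card_pos_iff.2 ⟨k⟩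
    rw [← mul_sub, norm_mul, le_div_iff₀ hc]
    have h1 : ‖α k + β k * (z - w k)‖ ≤ (a + b) * (2 * R + 3) := by
      have h2 : ‖z - w k‖ ≤ 2 * R + 2 := (norm_sub_le _ _).trans (by linarith [hu.norm_le k])
      calc _ ≤ ‖α k‖ + ‖β k‖ * ‖z - w k‖ := by
            rw [← norm_mul]; exact norm_add_le _ _
        _ ≤ a + b * (2 * R + 2) := by
            gcongr
            · exact hα k
            · exact hβ k
        _ ≤ _ := by nlinarith
    have h3 := hu.approx k z hz
    calc _ ≤ (a + b) * (2 * R + 3) * ‖u k z - coherent (w k) z‖ * Fintype.card ι := by gcongr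
      _ = (a + b) * (Fintype.card ι * ((2 * R + 3) * ‖u k z - coherent (w k) z‖)) := by ring
      _ ≤ (a + b) * (1 / 2000) := by gcongr
      _ = _ := by ring
  refine (norm_sum_le_of_le _ fun k _ => h k).trans ?_
  rw [Finset.sum_const, Finset.card_univ, nsmul_eq_mul]
  rcases eq_or_ne (Fintype.card ι : ℝ) 0 with h0 | h0
  · rw [h0, zero_mul]; positivity
  · exact (mul_div_cancel₀ _ h0).le

theorem norm_recenter_sub_le (hu : IsCoherentApprox w R u) (hα : ∀ k, ‖α k‖ ≤ a)
    (hβ : ∀ k, ‖β k‖ ≤ b) (ha : 0 ≤ a) (hb : 0 ≤ b) (j : ι) {ζ : ℂ} (hζ : ‖ζ‖ ≤ 13 / 10) :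
    ‖recenter (w j) (comb w u α β) ζ - recenter (w j) (comb w (fun k => coherent (w k)) α β) ζ‖ ≤
      3 / 2500 * (a + b) := by
  have h1 := hu.norm_comb_sub_le hα hβ ha hb (z := w j + ζ)
    ((norm_add_le _ _).trans (by linarith [hu.norm_le j]))
  have e : recenter (w j) (comb w u α β) ζ -
      recenter (w j) (comb w (fun k => coherent (w k)) α β) ζ =
      recenter (w j) (fun z => comb w u α β z - comb w (fun k => coherent (w k)) α β z) ζ := by
    simp only [recenter]; ring
  rw [e, norm_recenter]
  have h2 : Real.exp (‖ζ‖ ^ 2 / 2) ≤ 233 / 100 := by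
    refine le_trans ?_ exp_sq_div_two_le
    gcongr
  have h3 : Real.exp (-‖w j + ζ‖ ^ 2 / 2) ≤ 1 := Real.exp_le_one_iff.2 (by
    have := sq_nonneg ‖w j + ζ‖; linarith)
  calc _ ≤ (233 / 100 : ℝ) * (1 * ((a + b) / 2000)) := by gcongr
    _ ≤ _ := by linarith

/-- The derivative is controlled by Cauchy's estimate on the unit circle. -/
theorem norm_deriv_recenter_sub_le (hu : IsCoherentApprox w R u) (hα : ∀ k, ‖α k‖ ≤ a)
    (hβ : ∀ k, ‖β k‖ ≤ b) (ha : 0 ≤ a) (hb : 0 ≤ b) (j : ι) :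
    ‖deriv (recenter (w j) (comb w u α β)) 0 -
      deriv (recenter (w j) (comb w (fun k => coherent (w k)) α β)) 0‖ ≤ 3 / 2500 * (a + b) := by
  have d1 := differentiable_recenter (differentiable_comb (w := w) hu.differentiable α β) (w j)
  have d2 := differentiable_recenter (differentiable_comb (w := w)
    (fun k => differentiable_coherent (w k)) α β) (w j)
  rw [← deriv_sub (d1 0) (d2 0)]
  refine (Complex.norm_deriv_le_of_forall_mem_sphere_norm_le one_pos (d1.sub d2).diffContOnCl
    fun ζ hζ => ?_).trans (div_one _).le
  have : ‖ζ‖ = 1 := by simpa using hζ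
  exact hu.norm_recenter_sub_le hα hβ ha hb j (by rw [this]; norm_num)

/-- The linear system for the coefficients of a combination with prescribed values and derivatives,
seen from the points `w j`. -/
noncomputable def interpolation (hu : IsCoherentApprox w R u) :
    ((ι → ℂ) × (ι → ℂ)) →ₗ[ℂ] (ι → ℂ) × (ι → ℂ) where
  toFun x := (fun j => recenter (w j) (comb w u x.1 x.2) 0,
    fun j => deriv (recenter (w j) (comb w u x.1 x.2)) 0)
  map_add' x y := by
    have e : ∀ j, recenter (w j) (comb w u (x + y).1 (x + y).2) =
        recenter (w j) (comb w u x.1 x.2) + recenter (w j) (comb w u y.1 y.2) := by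
      intro j
      ext ζ
      simp only [recenter, comb, Pi.add_apply, Prod.fst_add, Prod.snd_add, ← add_mul,
        ← Finset.sum_add_distrib]
      congr 1
      exact Finset.sum_congr rfl fun k _ => by ring
    have d := fun (x : (ι → ℂ) × (ι → ℂ)) j => differentiable_recenter
      (differentiable_comb (w := w) hu.differentiable x.1 x.2) (w j)
    ext j
    · simp only [e]; rfl
    · simp only [e, deriv_add (d x j 0) (d y j 0)]; rfl
  map_smul' c x := by
    have e : ∀ j, recenter (w j) (comb w u (c • x).1 (c • x).2) =
        fun ζ => c * recenter (w j) (comb w u x.1 x.2) ζ := by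
      intro j
      ext ζ
      simp only [recenter, comb, Pi.smul_apply, Prod.smul_fst, Prod.smul_snd, smul_eq_mul,
        ← mul_assoc, Finset.mul_sum]
      congr 1
      exact Finset.sum_congr rfl fun k _ => by ring
    ext j
    · simp only [e]; rfl
    · simp only [e, deriv_const_mul_field]; rfl

/-- Stability of the interpolation system. The derivatives being prescribed as `0`, the coefficients
`β k` are small and `α k` is close to the prescribed value. -/
theorem norm_le_of_interpolation (hu : IsCoherentApprox w R u) (h : GaussSparse w)
    {ε : ι → ℂ} {t : ℝ} (ht : 0 ≤ t) (hε : ∀ j, ‖ε j‖ ≤ t)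
    (h1 : ∀ j, recenter (w j) (comb w u α β) 0 = ε j)
    (h2 : ∀ j, deriv (recenter (w j) (comb w u α β)) 0 = 0) :
    (∀ k, ‖α k‖ ≤ 1012 / 1000 * t) ∧ (∀ k, ‖β k‖ ≤ 486 / 10000 * t) ∧
      ∀ k, ‖α k - ε k‖ ≤ 112 / 10000 * t := by
  have hα : ∀ k, ‖α k‖ ≤ ‖α‖ := norm_le_pi_norm α
  have hβ : ∀ k, ‖β k‖ ≤ ‖β‖ := norm_le_pi_norm β
  have ha := norm_nonneg α
  have hb := norm_nonneg β
  have z0 : ‖(0 : ℂ)‖ ≤ 13 / 10 := by rw [norm_zero]; norm_num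
  have k1 : ∀ j, ‖α j - ε j‖ ≤ 3 / 2500 * (‖α‖ + ‖β‖) + (1 / 127 * ‖α‖ + 19 / 500 * ‖β‖) := by
    intro j
    have e1 := hu.norm_recenter_sub_le hα hβ ha hb j z0
    have e2 := h.norm_sub_recenter_le hα hβ j
    rw [h1] at e1
    rw [norm_sub_rev]
    refine le_trans ?_ (add_le_add e1 e2)
    refine le_trans (le_of_eq ?_) (norm_add_le _ _)
    congr 1
    ring
  have k2 : ∀ j, ‖β j‖ ≤ 3 / 2500 * (‖α‖ + ‖β‖) + (19 / 500 * ‖α‖ + 91 / 500 * ‖β‖) := by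
    intro j
    have e1 := hu.norm_deriv_recenter_sub_le hα hβ ha hb j
    have e2 := h.norm_sub_deriv_recenter_le hα hβ j
    rw [h2] at e1
    rw [← norm_neg]
    refine le_trans ?_ (add_le_add e1 e2)
    refine le_trans (le_of_eq ?_) (norm_add_le _ _)
    congr 1
    ring
  -- Diagonal dominance: these two inequalities determine the bounds on `‖α‖` and `‖β‖`.
  have k3 : ‖β‖ ≤ 3 / 2500 * (‖α‖ + ‖β‖) + (19 / 500 * ‖α‖ + 91 / 500 * ‖β‖) :=
    (pi_norm_le_iff_of_nonneg (by positivity)).2 k2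
  have k4 : ‖α‖ ≤ t + (3 / 2500 * (‖α‖ + ‖β‖) + (1 / 127 * ‖α‖ + 19 / 500 * ‖β‖)) := by
    refine (pi_norm_le_iff_of_nonneg (by positivity)).2 fun j => ?_
    have := norm_add_le (ε j) (α j - ε j)
    rw [add_sub_cancel] at this
    linarith [k1 j, hε j]
  refine ⟨fun k => (hα k).trans ?_, fun k => (hβ k).trans ?_, fun k => (k1 k).trans ?_⟩ <;>
    linarith

theorem interpolation_surjective (hu : IsCoherentApprox w R u) (h : GaussSparse w) :
    Function.Surjective hu.interpolation := by
  refine LinearMap.injective_iff_surjective.1 ((injective_iff_map_eq_zero _).2 fun x hx => ?_)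
  have h1 : ∀ j, recenter (w j) (comb w u x.1 x.2) 0 = (0 : ι → ℂ) j := fun j =>
    congrFun (congrArg Prod.fst hx) j
  have h2 : ∀ j, deriv (recenter (w j) (comb w u x.1 x.2)) 0 = 0 := fun j =>
    congrFun (congrArg Prod.snd hx) j
  obtain ⟨k1, k2, -⟩ := hu.norm_le_of_interpolation h le_rfl (by simp) h1 h2
  ext k
  · simpa using k1 k
  · simpa using k2 k

/-- The dual certificate: a combination of the functions `u k` which, after multiplication by the
weight, takes prescribed values of modulus `1` at the points `w j` and is smaller elsewhere. -/
theorem exists_comb (hu : IsCoherentApprox w R u) (h : GaussSparse w)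
    {ε : ι → ℂ} (hε : ∀ j, ‖ε j‖ = 1) : ∃ α β : ι → ℂ,
      (∀ j, (Real.exp (-‖w j‖ ^ 2 / 2) : ℂ) * comb w u α β (w j) = ε j) ∧
      ∀ z, ‖z‖ ≤ R → (∀ j, z ≠ w j) → Real.exp (-‖z‖ ^ 2 / 2) * ‖comb w u α β z‖ < 1 := by
  obtain ⟨⟨α, β⟩, hx⟩ := hu.interpolation_surjective h (ε, 0)
  have h1 : ∀ j, recenter (w j) (comb w u α β) 0 = ε j := fun j =>
    congrFun (congrArg Prod.fst hx) j
  have h2 : ∀ j, deriv (recenter (w j) (comb w u α β)) 0 = 0 := fun j =>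
    congrFun (congrArg Prod.snd hx) j
  obtain ⟨hα, hβ, hαε⟩ := hu.norm_le_of_interpolation h zero_le_one (fun j => (hε j).le) h1 h2
  refine ⟨α, β, fun j => by rw [← recenter_zero, h1], fun z hz hne => ?_⟩
  -- Away from all points, the Gaussian sum itself is bounded away from `1`.
  by_cases hfar : ∀ k, 13 / 10 ≤ ‖z - w k‖
  · have e1 := norm_comb_coherent_le (w := w) hα hβ z
    have e2 := hu.norm_comb_sub_le hα hβ (by norm_num) (by norm_num) (z := z) (by linarith)
    have e3 := h.gaussSum_le_of_away hfar
    have e4 := h.sum_norm_mul_le z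
    have e5 : Real.exp (-‖z‖ ^ 2 / 2) ≤ 1 := Real.exp_le_one_iff.2 (by
      have := sq_nonneg ‖z‖; linarith)
    have e6 := norm_sub_norm_le (comb w u α β z) (comb w (fun k => coherent (w k)) α β z)
    have e7 := mul_le_mul_of_nonneg_left (e6.trans e2) (Real.exp_pos (-‖z‖ ^ 2 / 2)).le
    linarith
  push Not at hfar
  obtain ⟨j, hj⟩ := hfar
  obtain ⟨ζ, rfl⟩ : ∃ ζ, z = w j + ζ := ⟨z - w j, by ring⟩
  rw [add_sub_cancel_left] at hj
  have hζ : 0 < ‖ζ‖ := norm_pos_iff.2 fun h0 => hne j (by rw [h0, add_zero])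
  have d := differentiable_recenter (differentiable_comb (w := w) hu.differentiable α β) (w j)
  -- Seen from `w j`, the combination equals `ε j` to second order.
  have hs : dist (recenter (w j) (comb w u α β) ζ) (recenter (w j) (comb w u α β) 0) ≤
      4 / 5 * (dist ζ 0 / (13 / 10)) ^ (1 + 1) := by
    refine Complex.dist_le_mul_div_pow_of_mapsTo_ball_of_isLittleO (c := (0 : ℂ))
      d.differentiableOn (fun ξ hξ => ?_) ?_ (by simpa using hj)
    · have hξ' : ‖ξ‖ ≤ 13 / 10 := by simpa using (Metric.mem_ball.1 hξ).le
      have e1 := h.norm_recenter_comb_sub_le hα hβ j hξ'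
      have e2 := hu.norm_recenter_sub_le hα hβ (by norm_num) (by norm_num) j hξ'
      have e3 := hαε j
      rw [Metric.mem_closedBall, dist_eq_norm, h1]
      have e4 := norm_add₃_le (a := recenter (w j) (comb w u α β) ξ -
        recenter (w j) (comb w (fun k => coherent (w k)) α β) ξ)
        (b := recenter (w j) (comb w (fun k => coherent (w k)) α β) ξ - α j) (c := α j - ε j)
      rw [sub_add_sub_cancel, sub_add_sub_cancel] at e4
      linarith
    · have hd := (d 0).hasDerivAt
      rw [h2, hasDerivAt_iff_isLittleO] at hd
      simpa using hd.norm_right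
  rw [h1, dist_eq_norm, dist_zero_right] at hs
  have e1 : ‖recenter (w j) (comb w u α β) ζ‖ < Real.exp (‖ζ‖ ^ 2 / 2) := by
    have e2 := norm_add_le (recenter (w j) (comb w u α β) ζ - ε j) (ε j)
    rw [sub_add_cancel, hε] at e2
    have e3 := Real.add_one_le_exp (‖ζ‖ ^ 2 / 2)
    have e4 : 0 < ‖ζ‖ ^ 2 := by positivity
    have e5 : (‖ζ‖ / (13 / 10)) ^ (1 + 1) = ‖ζ‖ ^ 2 * (100 / 169) := by ring
    rw [e5] at hs
    linarith
  rw [norm_recenter] at e1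
  exact (mul_lt_iff_lt_one_right (Real.exp_pos _)).1 e1

end IsCoherentApprox

end Certificate

/-! ### Polynomial certificates -/

open Polynomial in
/-- The certificates may be taken polynomial, of a degree bounded in terms of the points only. -/
theorem GaussSparse.exists_polynomial {ι : Type*} [Fintype ι] {w : ι → ℂ} (h : GaussSparse w)
    {R : ℝ} (hR : 0 ≤ R) (hw : ∀ k, ‖w k‖ ≤ R) :
    ∃ N : ℕ, ∀ ε : ι → ℂ, (∀ j, ‖ε j‖ = 1) → ∃ p : ℂ[X], p.natDegree < N ∧
      (∀ j, (Real.exp (-‖w j‖ ^ 2 / 2) : ℂ) * p.eval (w j) = ε j) ∧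
      ∀ z, ‖z‖ ≤ R → (∀ j, z ≠ w j) → Real.exp (-‖z‖ ^ 2 / 2) * ‖p.eval z‖ < 1 := by
  have hunif : TendstoUniformlyOn (fun (N : ℕ) (x : ℂ) => ∑ n ∈ Finset.range N, x ^ n / n.factorial)
      Complex.exp Filter.atTop (Metric.closedBall 0 ((R + 2) * R)) := by
    have h1 := tendstoUniformlyOn_tsum_nat (f := fun (n : ℕ) (x : ℂ) => x ^ n / n.factorial)
      (Real.summable_pow_div_factorial ((R + 2) * R))
      (s := Metric.closedBall 0 ((R + 2) * R)) (fun n x hx => by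
        rw [norm_div, norm_pow, Complex.norm_natCast]
        gcongr
        simpa using hx)
    refine h1.congr_right fun x _ => ?_
    rw [Complex.exp_eq_exp_ℂ, NormedSpace.exp_eq_tsum_div]
  set κ : ℝ := 1 / (2000 * ((Fintype.card ι + 1) * (2 * R + 3))) with hκ
  obtain ⟨N, hN⟩ := (Metric.tendstoUniformlyOn_iff.1 hunif κ (by positivity)).exists
  set q : ι → ℂ[X] := fun k => ∑ n ∈ Finset.range N,
    C ((Real.exp (-(‖w k‖ ^ 2 / 2)) : ℂ) * (conj (w k) ^ n / n.factorial)) * X ^ n with hq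
  have hqe : ∀ k z, (q k).eval z = (Real.exp (-(‖w k‖ ^ 2 / 2)) : ℂ) *
      ∑ n ∈ Finset.range N, (z * conj (w k)) ^ n / n.factorial := by
    intro k z
    simp only [hq, eval_finsetSum, eval_mul, eval_C, eval_pow, eval_X, Finset.mul_sum]
    exact Finset.sum_congr rfl fun n _ => by rw [mul_pow]; ring
  have hu : IsCoherentApprox w R (fun k z => (q k).eval z) := by
    refine ⟨hw, fun k => (q k).differentiable, fun k z hz => ?_⟩
    have h1 := hN (z * conj (w k)) (by
      rw [mem_closedBall_zero_iff, norm_mul, RCLike.norm_conj]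
      gcongr
      exact hw k)
    rw [dist_comm, dist_eq_norm] at h1
    have h2 : ‖(q k).eval z - coherent (w k) z‖ ≤ κ := by
      rw [hqe, coherent, sub_eq_neg_add (z * conj (w k)), Complex.exp_add, ← Complex.ofReal_neg,
        ← Complex.ofReal_exp, ← mul_sub, norm_mul, Complex.norm_real,
        Real.norm_of_nonneg (Real.exp_pos _).le]
      refine le_trans (mul_le_of_le_one_left (norm_nonneg _) (Real.exp_le_one_iff.2 ?_)) h1.le
      have := sq_nonneg ‖w k‖
      linarith
    calc _ ≤ ((Fintype.card ι : ℝ) + 1) * ((2 * R + 3) * κ) := by gcongr; linarith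
      _ = 1 / 2000 := by rw [hκ]; field_simp
      _ ≤ _ := le_rfl
  refine ⟨N + 2, fun ε hε => ?_⟩
  obtain ⟨α, β, h1, h2⟩ := hu.exists_comb h hε
  set p : ℂ[X] := ∑ k, (C (α k) + C (β k) * (X - C (w k))) * q k with hp
  have hpe : ∀ z, p.eval z = comb w (fun k z => (q k).eval z) α β z := by
    intro z
    simp [hp, comb, eval_finsetSum]
  refine ⟨p, ?_, fun j => by rw [hpe, h1], fun z => by rw [hpe]; exact h2 z⟩
  have hd : p.natDegree ≤ 1 + N := by
    refine natDegree_sum_le_of_forall_le _ _ fun k _ => natDegree_mul_le_of_le ?_ ?_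
    · compute_degree
    · refine natDegree_sum_le_of_forall_le _ _ fun n hn => ?_
      exact (natDegree_C_mul_X_pow_le _ _).trans (Finset.mem_range.1 hn).le
  omega

/-! ### Sparsity from the separation hypothesis -/

section Separation

variable {s : ℕ} (w : Fin s → ℂ)

theorem bddAbove_range_sigma : BddAbove (Set.range (sigma w)) := by
  refine ⟨∑ _j : Fin s, 4, ?_⟩
  rintro _ ⟨z, rfl⟩
  refine Finset.sum_le_sum fun j _ => ?_
  set t := ‖z - w j‖
  have h1 := Real.quadratic_le_exp_of_nonneg (x := t ^ 2 / 2) (by positivity)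
  rw [neg_div, Real.exp_neg, inv_mul_le_iff₀ (Real.exp_pos _)]
  nlinarith [sq_nonneg (t - 1), sq_nonneg (t ^ 2 - t), sq_nonneg t]

/-- A point at distance `3 / 2` from one of the `w j` shows that `σ↑` is large, so that the radius
in the definition of `farSup` is less than `1 / 8`. -/
theorem radius_lt (j : Fin s) : (Real.sqrt 5 - 1) / (4 * sigmaUp w) < 1 / 8 := by
  have h1 : 13 / 5 ≤ sigmaUp w := by
    refine le_trans ?_ (le_ciSup (bddAbove_range_sigma w) (w j + (3 / 2 : ℝ)))
    have h2 : Real.exp (-‖w j + (3 / 2 : ℝ) - w j‖ ^ 2 / 2) *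
        (1 + ‖w j + (3 / 2 : ℝ) - w j‖ + ‖w j + (3 / 2 : ℝ) - w j‖ ^ 2 +
          ‖w j + (3 / 2 : ℝ) - w j‖ ^ 3) ≤ sigma w (w j + (3 / 2 : ℝ)) :=
      Finset.single_le_sum (f := fun j' => Real.exp (-‖w j + (3 / 2 : ℝ) - w j'‖ ^ 2 / 2) *
        (1 + ‖w j + (3 / 2 : ℝ) - w j'‖ + ‖w j + (3 / 2 : ℝ) - w j'‖ ^ 2 +
          ‖w j + (3 / 2 : ℝ) - w j'‖ ^ 3)) (fun _ _ => by positivity) (Finset.mem_univ j)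
    refine le_trans ?_ h2
    have h3 : ‖w j + (3 / 2 : ℝ) - w j‖ = 3 / 2 := by
      rw [add_sub_cancel_left, Complex.norm_real]; norm_num
    rw [h3]
    have h4 : (32 / 100 : ℝ) ≤ Real.exp (-(3 / 2) ^ 2 / 2) := by
      have e : Real.exp (-(3 / 2) ^ 2 / 2) = (Real.exp 1)⁻¹ * Real.exp (-(1 / 8)) := by
        rw [← Real.exp_neg, ← Real.exp_add]; norm_num
      have h5 := Real.add_one_le_exp (-(1 / 8) : ℝ)
      have h6 : (36787 / 100000 : ℝ) ≤ (Real.exp 1)⁻¹ := by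
        rw [le_inv_comm₀ (by norm_num) (Real.exp_pos _)]
        refine Real.exp_one_lt_d9.le.trans (by norm_num)
      rw [e]
      calc (32 / 100 : ℝ) ≤ 36787 / 100000 * (-(1 / 8) + 1) := by norm_num
        _ ≤ _ := by gcongr
    linarith
  have h2 : Real.sqrt 5 ≤ 56 / 25 := Real.sqrt_le_iff.2 ⟨by norm_num, by norm_num⟩
  rw [div_lt_div_iff₀ (by linarith) (by norm_num)]
  linarith

theorem gaussSparse_of_farSup_le (h : farSup w ≤ 1) : GaussSparse w := by
  intro z hz
  rcases isEmpty_or_nonempty (Fin s) with h0 | ⟨⟨j⟩⟩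
  · simp [gaussSum]
  refine le_trans (le_csSup ?_ ?_) h
  · refine ⟨s, ?_⟩
    rintro _ ⟨z, -, rfl⟩
    refine (Finset.sum_le_sum (g := fun _ => (1 : ℝ)) fun k _ => Real.exp_le_one_iff.2 ?_).trans
      (by simp)
    have := sq_nonneg ‖z - w k‖
    linarith
  · refine ⟨z, (radius_lt w j).trans_le ?_, rfl⟩
    rw [Metric.le_infDist (⟨w j, j, rfl⟩ : (Set.range w).Nonempty)]
    rintro _ ⟨k, rfl⟩
    rw [dist_eq_norm]
    exact hz k

end Separation

/-! ### Recovery from dual certificates -/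

open Polynomial in
/-- The combination of the measurement vectors given by a polynomial. -/
noncomputable def polyVec (p : ℂ[X]) : PlaneL2 :=
  ∑ n ∈ Finset.range (p.natDegree + 1), (p.coeff n * (Real.sqrt n.factorial : ℂ)) •
    (mono n : PlaneL2)

theorem inner_polyVec_ker (p : Polynomial ℂ) (v : ℂ) :
    inner ℂ (polyVec p) (ker v : PlaneL2) =
      conj ((Real.exp (-‖v‖ ^ 2 / 2) : ℂ) * p.eval v) := by
  rw [polyVec, sum_inner, Polynomial.eval_eq_sum_range, Finset.mul_sum, map_sum]
  refine Finset.sum_congr rfl fun n _ => ?_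
  rw [inner_smul_left, inner_mono_ker, ← map_mul, monoFn]
  congr 1
  have : (Real.sqrt n.factorial : ℂ) ≠ 0 := by
    exact_mod_cast (Real.sqrt_pos.2 (by exact_mod_cast n.factorial_pos)).ne'
  field_simp

theorem inner_polyVec_congr {p : Polynomial ℂ} {N : ℕ} (hp : p.natDegree < N) {f g : PlaneL2}
    (h : ∀ n < N, inner ℂ (mono n : PlaneL2) f = inner ℂ (mono n : PlaneL2) g) :
    inner ℂ (polyVec p) f = inner ℂ (polyVec p) g := by
  rw [polyVec, sum_inner, sum_inner]
  refine Finset.sum_congr rfl fun n hn => ?_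
  rw [inner_smul_left, inner_smul_left, h n (by have := Finset.mem_range.1 hn; omega)]

section Recovery

variable {Ω : Set ℂ} {s : ℕ} {w : Fin s → Ω}

/-- `N` measurements admit a dual certificate for every choice of phases at the points `w k`. -/
def HasCertificates (w : Fin s → Ω) (N : ℕ) : Prop :=
  ∀ ε : Fin s → ℂ, (∀ j, ‖ε j‖ = 1) → ∃ p : Polynomial ℂ, p.natDegree < N ∧
    (∀ j, (Real.exp (-‖(w j : ℂ)‖ ^ 2 / 2) : ℂ) * p.eval (w j : ℂ) = ε j) ∧
    ∀ z ∈ Ω, (∀ j, z ≠ w j) → Real.exp (-‖z‖ ^ 2 / 2) * ‖p.eval z‖ < 1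

/-- A measure consistent with the measurements pairs with a certificate as `∑ k, c k • δ_{w k}`
does. -/
theorem integral_certificate {c : Fin s → ℂ} {N : ℕ} {ν : ComplexMeasure Ω}
    (hν : ∀ n < N, inner ℂ (mono n : PlaneL2) (synth ν) =
      inner ℂ (mono n : PlaneL2) (synth (spikes w c)))
    (hfin : tvNorm ν ≠ ∞) {p : Polynomial ℂ} (hp : p.natDegree < N) :
    VectorMeasure.integral ν
      (fun v : Ω => conj ((Real.exp (-‖(v : ℂ)‖ ^ 2 / 2) : ℂ) * p.eval (v : ℂ)))
      (ContinuousLinearMap.lsmul ℝ ℂ (E := ℂ)).flip =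
    ∑ k, c k * conj ((Real.exp (-‖(w k : ℂ)‖ ^ 2 / 2) : ℂ) * p.eval (w k : ℂ)) := by
  have h := inner_synth (polyVec p) ν hfin
  rw [inner_polyVec_congr hp hν, synth_spikes, inner_sum] at h
  simp only [inner_smul_right, inner_polyVec_ker] at h
  exact h.symm

/-- After multiplication by the weight, a certificate is at most `1` on `Ω`, with equality only on
`w`. -/
theorem norm_certificate_le {p : Polynomial ℂ} {ε : Fin s → ℂ} (hε : ∀ j, ‖ε j‖ = 1)
    (h1 : ∀ j, (Real.exp (-‖(w j : ℂ)‖ ^ 2 / 2) : ℂ) * p.eval (w j : ℂ) = ε j)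
    (h2 : ∀ z ∈ Ω, (∀ j, z ≠ w j) → Real.exp (-‖z‖ ^ 2 / 2) * ‖p.eval z‖ < 1) (v : Ω) :
    ‖conj ((Real.exp (-‖(v : ℂ)‖ ^ 2 / 2) : ℂ) * p.eval (v : ℂ))‖ ≤ 1 ∧
    (v ∉ Set.range w →
      ‖conj ((Real.exp (-‖(v : ℂ)‖ ^ 2 / 2) : ℂ) * p.eval (v : ℂ))‖ < 1) := by
  rw [RCLike.norm_conj]
  by_cases hv : v ∈ Set.range w
  · obtain ⟨j, rfl⟩ := hv
    exact ⟨by rw [h1, hε], fun h => absurd ⟨j, rfl⟩ h⟩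
  · have : ‖(Real.exp (-‖(v : ℂ)‖ ^ 2 / 2) : ℂ) * p.eval (v : ℂ)‖ < 1 := by
      rw [norm_mul, Complex.norm_real, Real.norm_of_nonneg (Real.exp_pos _).le]
      exact h2 v v.2 fun j hj => hv ⟨j, Subtype.ext hj.symm⟩
    exact ⟨this.le, fun _ => this⟩

/-- The phase of a complex number, and `1` for `0`. -/
noncomputable def phase (a : ℂ) : ℂ := if a = 0 then 1 else a / ‖a‖

theorem norm_phase (a : ℂ) : ‖phase a‖ = 1 := by
  unfold phase
  split_ifs with h
  · simp
  · rw [norm_div, Complex.norm_real, norm_norm, div_self (norm_ne_zero_iff.2 h)]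

theorem mul_conj_phase (a : ℂ) : a * conj (phase a) = (‖a‖ : ℂ) := by
  unfold phase
  split_ifs with h
  · simp [h]
  · have : (‖a‖ : ℂ) ≠ 0 := by exact_mod_cast norm_ne_zero_iff.2 h
    rw [map_div₀, Complex.conj_ofReal, mul_div_assoc', Complex.mul_conj, Complex.normSq_eq_norm_sq]
    field_simp
    norm_cast

/-- Pairing with the certificate for the phases of `c` gives the sum of the `|c k|`. -/
theorem HasCertificates.exists_pairing {N : ℕ} (h : HasCertificates w N) {c : Fin s → ℂ}
    {ν : ComplexMeasure Ω} (hν : ∀ n < N, inner ℂ (mono n : PlaneL2) (synth ν) =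
      inner ℂ (mono n : PlaneL2) (synth (spikes w c))) (hfin : tvNorm ν ≠ ∞) :
    ∃ g : Ω → ℂ, Measurable g ∧ (∀ v, ‖g v‖ ≤ 1) ∧ (∀ v ∉ Set.range w, ‖g v‖ < 1) ∧
      ∑ k, ‖c k‖ₑ =
        ‖VectorMeasure.integral ν g (ContinuousLinearMap.lsmul ℝ ℂ (E := ℂ)).flip‖ₑ := by
  obtain ⟨p, hp, h1, h2⟩ := h (fun k => phase (c k)) fun k => norm_phase _
  have hc : Continuous fun v : Ω =>
      conj ((Real.exp (-‖(v : ℂ)‖ ^ 2 / 2) : ℂ) * p.eval (v : ℂ)) := by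
    have := p.continuous
    fun_prop
  refine ⟨_, hc.measurable, fun v => (norm_certificate_le (fun k => norm_phase _) h1 h2 v).1,
    fun v => (norm_certificate_le (fun k => norm_phase _) h1 h2 v).2, ?_⟩
  rw [integral_certificate hν hfin hp]
  simp only [h1, mul_conj_phase]
  rw [← Complex.ofReal_sum, ← ofReal_norm, Complex.norm_real,
    Real.norm_of_nonneg (Finset.sum_nonneg fun _ _ => norm_nonneg _),
    ENNReal.ofReal_sum_of_nonneg fun _ _ => norm_nonneg _]
  exact Finset.sum_congr rfl fun k _ => (ofReal_norm _).symm

/-- A certificate shows that no consistent measure has smaller total variation than the spikes. -/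
theorem HasCertificates.tvNorm_spikes_le {N : ℕ} (h : HasCertificates w N) {c : Fin s → ℂ}
    {ν : ComplexMeasure Ω} (hν : ∀ n < N, inner ℂ (mono n : PlaneL2) (synth ν) =
      inner ℂ (mono n : PlaneL2) (synth (spikes w c))) :
    tvNorm (spikes w c) ≤ tvNorm ν := by
  by_cases hfin : tvNorm ν = ∞
  · rw [hfin]; exact le_top
  obtain ⟨g, -, hg, -, he⟩ := h.exists_pairing hν hfin
  refine (tvNorm_spikes_le_sum w c).trans (he.le.trans
    (VectorMeasure.enorm_integral_le_lintegral_enorm.trans ?_))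
  have h1 : ‖(ContinuousLinearMap.lsmul ℝ ℂ (E := ℂ)).flip‖ₑ ≤ 1 := by
    rw [← ofReal_norm, ← ENNReal.ofReal_one]
    exact ENNReal.ofReal_le_ofReal norm_lsmul_flip_le
  have h2 : ∫⁻ v, ‖g v‖ₑ ∂ν.variation ≤ ∫⁻ _, 1 ∂ν.variation := lintegral_mono fun v => by
    rw [← ofReal_norm, ← ENNReal.ofReal_one]
    exact ENNReal.ofReal_le_ofReal (hg v)
  rw [lintegral_one] at h2
  calc _ ≤ 1 * ν.variation Set.univ := mul_le_mul' h1 h2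
    _ = tvNorm ν := one_mul _

/-- A consistent measure of total variation at most that of the spikes is supported on `w`, and
there it is determined by its pairings with the certificates. -/
theorem HasCertificates.eq_spikes {N : ℕ} (h : HasCertificates w N) (hw : Function.Injective w)
    {c : Fin s → ℂ} {ν : ComplexMeasure Ω}
    (hν : ∀ n < N, inner ℂ (mono n : PlaneL2) (synth ν) =
      inner ℂ (mono n : PlaneL2) (synth (spikes w c))) (hle : tvNorm ν ≤ tvNorm (spikes w c)) :
    ν = spikes w c := by
  have hfin : tvNorm ν ≠ ∞ := by
    refine ne_top_of_le_ne_top ?_ (hle.trans (tvNorm_spikes_le_sum w c))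
    exact ENNReal.sum_ne_top.2 fun _ _ => enorm_ne_top
  obtain ⟨g, hgm, hg, hg', he⟩ := h.exists_pairing hν hfin
  have h0 := variation_compl_eq_zero_of_le_norm_integral ν hfin hgm hg hg'
    ((hle.trans (tvNorm_spikes_le_sum w c)).trans he.le)
  obtain ⟨b, rfl⟩ : ∃ b, ν = spikes w b :=
    ⟨fun k => ν {w k}, eq_sum_dirac_of_variation_compl_eq_zero ν hw h0⟩
  have hpair : ∀ ε : Fin s → ℂ, (∀ j, ‖ε j‖ = 1) →
      ∑ k, b k * conj (ε k) = ∑ k, c k * conj (ε k) := by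
    intro ε hε
    obtain ⟨p, hp, h1, -⟩ := h ε hε
    have h2 := integral_certificate hν hfin hp
    rw [integral_spikes] at h2
    simpa only [h1, smul_eq_mul] using h2
  congr 1
  ext k
  -- Changing the phase at `w k` from `1` to `-1` isolates the `k`-th coefficient.
  have e1 := hpair (fun _ => 1) fun _ => norm_one
  have e2 := hpair (Function.update (fun _ => 1) k (-1)) fun j => by
    by_cases hj : j = k
    · rw [hj, Function.update_self, norm_neg, norm_one]
    · rw [Function.update_of_ne hj, norm_one]
  rw [← Finset.add_sum_erase _ _ (Finset.mem_univ k),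
    ← Finset.add_sum_erase _ _ (Finset.mem_univ k)] at e1 e2
  have e3 : ∀ b : Fin s → ℂ, ∑ j ∈ Finset.univ.erase k,
      b j * conj ((Function.update (fun _ => 1) k (-1) : Fin s → ℂ) j) =
      ∑ j ∈ Finset.univ.erase k, b j * conj 1 := fun b =>
    Finset.sum_congr rfl fun j hj => by rw [Function.update_of_ne (Finset.ne_of_mem_erase hj)]
  rw [e3, e3 c, Function.update_self] at e2
  simp only [map_neg, map_one] at e1 e2
  linear_combination (e1 - e2) / 2

end Recovery

end GaussianRadar

theorem mainTheorem6 (R : ℝ) (hR : 1 ≤ R) (s : ℕ)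
    (w : Fin s → Metric.closedBall (0 : ℂ) R) (hw : Function.Injective w)
    (τ : ℝ) (hτ : 0 < τ)
    (hsep : GaussianRadar.farSup (fun k => (w k : ℂ)) < 1 - τ) :
    ∃ N₀ : ℕ, ∀ (c : Fin s → ℂ) (f₀ : GaussianRadar.radarSpace),
      f₀ = ∑ k, c k • GaussianRadar.ker (w k : ℂ) →
      (∀ N ≥ N₀, ∀ μ : ComplexMeasure (Metric.closedBall (0 : ℂ) R),
        GaussianRadar.IsTVMinimizer
          {ν : ComplexMeasure (Metric.closedBall (0 : ℂ) R) | ∀ n < N,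
            inner ℂ (GaussianRadar.mono n : GaussianRadar.PlaneL2) (GaussianRadar.synth ν) =
              inner ℂ (GaussianRadar.mono n) f₀} μ ↔
          μ = GaussianRadar.spikes w c) ∧
      (∀ μ : ComplexMeasure (Metric.closedBall (0 : ℂ) R),
        GaussianRadar.IsTVMinimizer
          {ν : ComplexMeasure (Metric.closedBall (0 : ℂ) R) |
            GaussianRadar.synth ν = (f₀ : GaussianRadar.PlaneL2)} μ ↔
          μ = GaussianRadar.spikes w c) ∧
      GaussianRadar.synth (GaussianRadar.spikes w c) = (f₀ : GaussianRadar.PlaneL2) := by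
  obtain ⟨N₀, hN₀⟩ := (GaussianRadar.gaussSparse_of_farSup_le (fun k => (w k : ℂ))
    (by linarith)).exists_polynomial (R := R) (by linarith)
    (fun k => mem_closedBall_zero_iff.1 (w k).2)
  have hcert : GaussianRadar.HasCertificates w N₀ := fun ε hε => by
    obtain ⟨p, hp, h1, h2⟩ := hN₀ ε hε
    exact ⟨p, hp, h1, fun z hz => h2 z (mem_closedBall_zero_iff.1 hz)⟩
  refine ⟨N₀, fun c f₀ hf => ?_⟩
  have hf₀ : GaussianRadar.synth (GaussianRadar.spikes w c) = (f₀ : GaussianRadar.PlaneL2) := by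
    rw [GaussianRadar.synth_spikes, hf]
    simp
  -- Every feasible set in question contains the spikes and lies in the one given by the first `N₀`
  -- measurements.
  have key : ∀ S : Set (ComplexMeasure (Metric.closedBall (0 : ℂ) R)),
      GaussianRadar.spikes w c ∈ S →
      (∀ ν ∈ S, ∀ n < N₀, inner ℂ (GaussianRadar.mono n : GaussianRadar.PlaneL2)
        (GaussianRadar.synth ν) = inner ℂ (GaussianRadar.mono n : GaussianRadar.PlaneL2)
          (GaussianRadar.synth (GaussianRadar.spikes w c))) →
      ∀ μ, GaussianRadar.IsTVMinimizer S μ ↔ μ = GaussianRadar.spikes w c := by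
    intro S h0 hS μ
    constructor
    · exact fun h => hcert.eq_spikes hw (hS μ h.1) (h.2 _ h0)
    · rintro rfl
      exact ⟨h0, fun ν hν => hcert.tvNorm_spikes_le (hS ν hν)⟩
  refine ⟨fun N hN => key _ (fun n _ => ?_) fun ν hν n hn => ?_, key _ hf₀ fun ν hν n _ => ?_, hf₀⟩
  · rw [hf₀]; rfl
  · rw [hf₀]; exact hν n (hn.trans_le hN)
  · rw [hf₀, hν]
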